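/- For $i=1,2$ let $d_i\in\mathbb{Z}_{>0}$, let $R_{d_i}^+=\mathbb{Z}[u_1,\dots,u_{d_i}]$ and $R_{d_i}=\mathbb{Z}[u_1^{\pm1},\dots,u_{d_i}^{\pm1}]$, let $I_i$ be a non-zero ideal of $R_{d_i}^+$ such that the additive group of $R_{d_i}^+/I_i$ is finitely generated and torsion-free, and let $V(I_i)\subseteq\mathbb{C}^{d_i}$ be the set of common zeros of $I_i$. Write $\dot u_k$ for the class of $u_k$ in $R_{d_i}^+/I_i$, and $N(a)=|\det(x\mapsto ax)|$ for the determinant of multiplication by $a\in R_{d_i}^+/I_i$ on the $\mathbb{Q}$-vector space $\mathbb{Q}\otimes_{\mathbb{Z}}(R_{d_i}^+/I_i)$. Assume that for $i=1,2$: (a) $\#V(I_i)<\infty$ and $u_k\notin I_i$ for all $k=1,\dots,d_i$; (b) $z_k\neq0$ for every $z\in V(I_i)$ and every $k=1,\dots,d_i$; (c) there is a monomial $f=u_1^{n_1}\cdots u_{d_i}^{n_{d_i}}$ with $f(z)\neq1$ for all $z\in V(I_i)$; (d) for each $1\le j\le d_i$ there is a rational prime $p$ with $p\mid N(\dot u_j)$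 and $p\nmid N(\dot u_k)$ for all $k\neq j$. Let $\mathbb{N}^{d_i}$ act on the additive group $A_i=R_{d_i}^+/I_i$ by letting $n$ act as multiplication by $\dot u^n=\dot u_1^{n_1}\cdots\dot u_{d_i}^{n_{d_i}}$. Let $\mathcal C_i$ be the smallest family of subgroups of $A_i$ that contains $A_i$ and is closed under images and preimages under these endomorphisms, and let $\Omega_{I_i}=\varprojlim_{C\in\mathcal C_i}A_i/C$, with the inverse limit topology of the discrete groups $A_i/C$. The group $\mathbb{Z}^{d_i}$ acts on $R_{d_i}/I_iR_{d_i}$ by multiplication by Laurent monomials, and the discrete group $R_{d_i}/I_iR_{d_i}\rtimes\mathbb{Z}^{d_i}$ acts on $R_{d_i}/I_iR_{d_i}\supseteq A_i$ by $(b,n).x=b+u^nx$. Restricting this to $A_i$ gives a partial action on $A_i$, which extends by continuity to a partial action on $\Omega_{I_i}$; let $(R_{d_i}/I_iR_{d_i}\rtimes\mathbb{Z}^{d_i})\ltimes\Omega_{I_i}$ be the corresponding transformation groupoid of all pairs $(g,x)$ with $x\in\Omega_{I_i}$ in the domain of $g$, topologized as a subspace of $(R_{d_i}/I_iR_{d_i}\rtimes\mathbb{Z}^{d_i})\times\Omega_{I_i}$.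 Then the following are equivalent: (i) the actions $\mathbb{N}^{d_1}\curvearrowright R_{d_1}^+/I_1$ and $\mathbb{N}^{d_2}\curvearrowright R_{d_2}^+/I_2$ are isomorphic, i.e. there are a monoid isomorphism $\mathfrak t\colon\mathbb{N}^{d_1}\to\mathbb{N}^{d_2}$ and a group isomorphism $\mathfrak b\colon A_1\to A_2$ with $\mathfrak b(\dot u^{n}x)=\dot u^{\mathfrak t(n)}\mathfrak b(x)$ for all $n\in\mathbb{N}^{d_1}$, $x\in A_1$; (ii) the groupoids $(R_{d_1}/I_1R_{d_1}\rtimes\mathbb{Z}^{d_1})\ltimes\Omega_{I_1}$ and $(R_{d_2}/I_2R_{d_2}\rtimes\mathbb{Z}^{d_2})\ltimes\Omega_{I_2}$ are isomorphic as topological groupoids. -/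

import Mathlib

open scoped TensorProduct
open CategoryTheory

noncomputable section

namespace AlgAct

/-! ### Actions of monoids by group endomorphisms, constructible subgroups, completion -/

section Actions

variable {S A T B : Type} [Monoid S] [AddCommGroup A] [Monoid T] [AddCommGroup B]

/-- Two actions `σ : S ↷ A`, `τ : T ↷ B` by group endomorphisms are isomorphic if there are
isomorphisms `𝔱 : S ≃ T` and `𝔟 : A ≃ B` with `𝔟 (σ_s x) = τ_{𝔱 s} (𝔟 x)`. -/
def ActionsIsomorphic (σ : S →* AddMonoid.End A) (τ : T →* AddMonoid.End B) : Prop :=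
  ∃ (t : S ≃* T) (b : A ≃+ B), ∀ (s : S) (x : A), b (σ s x) = τ (t s) (b x)

/-- The endomorphism `σ_s` of `A`. -/
def endo (σ : S →* AddMonoid.End A) (s : S) : A →+ A := σ s

theorem endo_apply (σ : S →* AddMonoid.End A) (s : S) (a : A) : endo σ s a = σ s a := rfl

/-- The `S`-constructible subgroups of `A`: the smallest family of subgroups which contains `A`
and is closed under images and preimages under the endomorphisms `σ_s`. -/
inductive IsConstructible (σ : S →* AddMonoid.End A) : AddSubgroup A → Prop
  | whole : IsConstructible σ ⊤
  | image (s : S) (C : AddSubgroup A) (hC : IsConstructible σ C) :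
      IsConstructible σ (AddSubgroup.map (endo σ s) C)
  | preimage (s : S) (C : AddSubgroup A) (hC : IsConstructible σ C) :
      IsConstructible σ (AddSubgroup.comap (endo σ s) C)

/-- The index set of the inverse system: the constructible subgroups. -/
abbrev Constructible (σ : S →* AddMonoid.End A) : Type :=
  {C : AddSubgroup A // IsConstructible σ C}

/-- The projection `A / C → A / D` for `C ≤ D`. -/
def proj {C D : AddSubgroup A} (h : C ≤ D) : A ⧸ C →+ A ⧸ D :=
  QuotientAddGroup.map C D (AddMonoidHom.id A) h

/-- The inverse limit `lim A / C` over the constructible subgroups `C`, as a subgroup of the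
product of all `A / C`. -/
def completionSubgroup (σ : S →* AddMonoid.End A) :
    AddSubgroup (∀ C : Constructible σ, A ⧸ C.1) where
  carrier := {x | ∀ (C D : Constructible σ) (h : C.1 ≤ D.1), proj h (x C) = x D}
  add_mem' := by
    intro x y hx hy C D h
    simp only [Pi.add_apply, map_add, hx C D h, hy C D h]
  zero_mem' := by
    intro C D h
    simp
  neg_mem' := by
    intro x hx C D h
    simp only [Pi.neg_apply, map_neg, hx C D h]

/-- The completion `Ā` of `A` with respect to the constructible subgroups. -/
abbrev Completion (σ : S →* AddMonoid.End A) : Type := completionSubgroup σ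

/-- The inverse limit topology on `Ā`: each `A / C` is discrete. -/
abbrev completionTopology (σ : S →* AddMonoid.End A) : TopologicalSpace (Completion σ) :=
  TopologicalSpace.induced (fun x => x.1)
    (@Pi.topologicalSpace (Constructible σ) (fun C => A ⧸ C.1) (fun _ => ⊥))

/-- The canonical homomorphism `A → Ā`. -/
def toCompletion (σ : S →* AddMonoid.End A) : A →+ Completion σ where
  toFun a := ⟨fun _ => QuotientAddGroup.mk a, fun _ _ _ => rfl⟩
  map_zero' := rfl
  map_add' _ _ := rfl

/-- The constructible subgroup `σ_s⁻¹ D`. -/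
def pre (σ : S →* AddMonoid.End A) (s : S) (D : Constructible σ) : Constructible σ :=
  ⟨AddSubgroup.comap (endo σ s) D.1, IsConstructible.preimage s D.1 D.2⟩

/-- The extension of `σ_s` to `Ā`: its component at `D` is induced by `σ_s : σ_s⁻¹ D → D`. -/
def completionMap (σ : S →* AddMonoid.End A) (s : S) : Completion σ →+ Completion σ where
  toFun x :=
    ⟨fun D => QuotientAddGroup.map (pre σ s D).1 D.1 (endo σ s) le_rfl (x.1 (pre σ s D)), by
      intro C D h
      have h' : (pre σ s C).1 ≤ (pre σ s D).1 := AddSubgroup.comap_mono h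
      have hx := x.2 (pre σ s C) (pre σ s D) h'
      obtain ⟨a, ha⟩ := QuotientAddGroup.mk_surjective (x.1 (pre σ s C))
      change proj h (QuotientAddGroup.map _ C.1 (endo σ s) le_rfl (x.1 (pre σ s C))) =
        QuotientAddGroup.map _ D.1 (endo σ s) le_rfl (x.1 (pre σ s D))
      rw [← hx, ← ha]
      rfl⟩
  map_zero' := by
    apply Subtype.ext
    funext D
    exact map_zero _
  map_add' x y := by
    apply Subtype.ext
    funext D
    exact map_add _ _ _

theorem completionMap_apply (σ : S →* AddMonoid.End A) (s : S) (x : Completion σ)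
    (D : Constructible σ) (a : A) (h : x.1 (pre σ s D) = QuotientAddGroup.mk a) :
    (completionMap σ s x).1 D = QuotientAddGroup.mk (σ s a) := by
  change QuotientAddGroup.map (pre σ s D).1 D.1 (endo σ s) le_rfl (x.1 (pre σ s D)) = _
  rw [h]
  rfl

theorem completionMap_one (σ : S →* AddMonoid.End A) (x : Completion σ) :
    completionMap σ 1 x = x := by
  apply Subtype.ext
  funext D
  obtain ⟨a, ha⟩ := QuotientAddGroup.mk_surjective (x.1 (pre σ 1 D))
  have hle : (pre σ 1 D).1 ≤ D.1 := by
    intro y hy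
    have hy' : σ 1 y ∈ D.1 := hy
    simpa using hy'
  rw [completionMap_apply σ 1 x D a ha.symm, ← x.2 _ D hle, ← ha, map_one]
  rfl

theorem completionMap_mul (σ : S →* AddMonoid.End A) (s t : S) (x : Completion σ) :
    completionMap σ (s * t) x = completionMap σ s (completionMap σ t x) := by
  apply Subtype.ext
  funext D
  obtain ⟨a, ha⟩ := QuotientAddGroup.mk_surjective (x.1 (pre σ t (pre σ s D)))
  have hle : (pre σ t (pre σ s D)).1 ≤ (pre σ (s * t) D).1 := by
    intro y hy
    change σ (s * t) y ∈ D.1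
    rw [map_mul]
    exact hy
  have h1 : x.1 (pre σ (s * t) D) = QuotientAddGroup.mk a := by
    rw [← x.2 _ _ hle, ← ha]
    rfl
  rw [completionMap_apply σ (s * t) x D a h1,
    completionMap_apply σ s _ D (σ t a) (completionMap_apply σ t x _ a ha.symm), map_mul]
  rfl

theorem completionMap_toCompletion (σ : S →* AddMonoid.End A) (s : S) (a : A) :
    completionMap σ s (toCompletion σ a) = toCompletion σ (σ s a) := rfl

end Actions

/-! ### Topological groupoids -/

section Groupoids

/-- The set of all arrows of a groupoid. -/
abbrev Arrows (X : Type) [Groupoid.{0} X] : Type := Σ x y : X, (x ⟶ y)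

/-- The map on arrow sets given by a functor (that is, a groupoid homomorphism). -/
def mapArrows {X Y : Type} [Groupoid.{0} X] [Groupoid.{0} Y] (F : X ⥤ Y) :
    Arrows X → Arrows Y :=
  fun a => ⟨F.obj a.1, F.obj a.2.1, F.map a.2.2⟩

/-- Two groupoids with topologies on their arrow sets are isomorphic as topological groupoids if
some groupoid homomorphism is a homeomorphism between the arrow sets. -/
def TopGroupoidsIsomorphic (X Y : Type) [Groupoid.{0} X] [Groupoid.{0} Y]
    [TopologicalSpace (Arrows X)] [TopologicalSpace (Arrows Y)] : Prop :=
  ∃ F : X ⥤ Y, IsHomeomorph (mapArrows F)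

end Groupoids

/-! ### The `ℕ^d`-action on `ℤ[u₁,…,u_d] / I` and its groupoid -/

section Ideals

variable {d : ℕ}

/-- The ring `ℤ[u₁,…,u_d]`. -/
abbrev PolyRing (d : ℕ) : Type := MvPolynomial (Fin d) ℤ

/-- The complex variety `V(I) ⊆ ℂ^d`. -/
def variety (I : Ideal (PolyRing d)) : Set (Fin d → ℂ) :=
  {z | ∀ f ∈ I, MvPolynomial.aeval z f = 0}

/-- The monomial `u₁^{n₁} ⋯ u_d^{n_d}`. -/
def mono (n : Fin d → ℕ) : PolyRing d := ∏ k, MvPolynomial.X k ^ n k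

/-- The class `u̇_k` of `u_k` modulo `I`. -/
def udot (I : Ideal (PolyRing d)) (k : Fin d) : PolyRing d ⧸ I :=
  Ideal.Quotient.mk I (MvPolynomial.X k)

/-- `N(a) = |det (x ↦ a x)|`, for the multiplication operator on `ℚ ⊗ R`. -/
def absNorm {R : Type} [CommRing R] (a : R) : ℚ :=
  |LinearMap.det ((LinearMap.mulLeft ℤ a).baseChange ℚ : ℚ ⊗[ℤ] R →ₗ[ℚ] ℚ ⊗[ℤ] R)|

theorem mono_zero : mono (0 : Fin d → ℕ) = 1 := by simp [mono]

theorem mono_add (m n : Fin d → ℕ) : mono (m + n) = mono m * mono n := by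
  simp [mono, pow_add, Finset.prod_mul_distrib]

/-- The action `ℕ^d ↷ ℤ[u₁,…,u_d] / I`: the element `n` acts by multiplication by the class of
`u₁^{n₁} ⋯ u_d^{n_d}`. -/
def act (I : Ideal (PolyRing d)) :
    Multiplicative (Fin d → ℕ) →* AddMonoid.End (PolyRing d ⧸ I) where
  toFun n := AddMonoid.End.mulLeft (Ideal.Quotient.mk I (mono n.toAdd))
  map_one' := by
    rw [toAdd_one, mono_zero, map_one]
    exact AddMonoidHom.ext one_mul
  map_mul' m n := by
    rw [toAdd_mul, mono_add, map_mul]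
    exact AddMonoidHom.ext (mul_assoc _ _)

theorem act_apply (I : Ideal (PolyRing d)) (n : Multiplicative (Fin d → ℕ))
    (x : PolyRing d ⧸ I) : act I n x = Ideal.Quotient.mk I (mono n.toAdd) * x := rfl

/-- The ring `R_d = ℤ[u₁^{±1},…,u_d^{±1}]` of Laurent polynomials. -/
abbrev Laurent (d : ℕ) : Type := AddMonoidAlgebra ℤ (Fin d → ℤ)

/-- The canonical map from polynomials to Laurent polynomials. -/
def polyToLaurent (d : ℕ) : PolyRing d →+* Laurent d :=
  (MvPolynomial.aeval (fun k : Fin d =>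
    (AddMonoidAlgebra.single (Pi.single k (1 : ℤ)) (1 : ℤ) : Laurent d))).toRingHom

/-- The ideal `I R_d` of the Laurent polynomial ring. -/
abbrev laurentIdeal (I : Ideal (PolyRing d)) : Ideal (Laurent d) := I.map (polyToLaurent d)

/-- The ring `R_d / I R_d`. -/
abbrev LaurentQuot (I : Ideal (PolyRing d)) : Type := Laurent d ⧸ laurentIdeal I

/-- The canonical map `ℤ[u₁,…,u_d] / I → R_d / I R_d`. -/
def quotToLaurent (I : Ideal (PolyRing d)) : PolyRing d ⧸ I →+* LaurentQuot I :=
  Ideal.quotientMap (laurentIdeal I) (polyToLaurent d) Ideal.le_comap_map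

/-- The class of the Laurent monomial `u₁^{n₁} ⋯ u_d^{n_d}` in `R_d / I R_d`. -/
def zmono (I : Ideal (PolyRing d)) : Multiplicative (Fin d → ℤ) →* LaurentQuot I :=
  (Ideal.Quotient.mk (laurentIdeal I) : Laurent d →* LaurentQuot I).comp
    (AddMonoidAlgebra.of ℤ (Fin d → ℤ))

/-- The action of `ℤ^d` on the additive group of `R_d / I R_d` by multiplication by Laurent
monomials. -/
def zact (I : Ideal (PolyRing d)) :
    Multiplicative (Fin d → ℤ) →* MulAut (Multiplicative (LaurentQuot I)) where
  toFun n :=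
    { toFun := fun b => Multiplicative.ofAdd (zmono I n * b.toAdd)
      invFun := fun b => Multiplicative.ofAdd (zmono I n⁻¹ * b.toAdd)
      left_inv := fun b => by
        simp [← mul_assoc, ← map_mul]
      right_inv := fun b => by
        simp [← mul_assoc, ← map_mul]
      map_mul' := fun b c => by
        simp [mul_add] }
  map_one' := by
    ext b
    simp
  map_mul' m n := by
    ext b
    simp [mul_assoc]

/-- The group `R_d / I R_d ⋊ ℤ^d`, with `(b, n) (b', n') = (b + u^n b', n + n')`. -/
abbrev AffGroup (I : Ideal (PolyRing d)) : Type :=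
  Multiplicative (LaurentQuot I) ⋊[zact I] Multiplicative (Fin d → ℤ)

/-- The completion `Ω_I` of `ℤ[u₁,…,u_d] / I` with respect to the constructible subgroups of the
`ℕ^d`-action. -/
abbrev Omega (I : Ideal (PolyRing d)) : Type := Completion (act I)

/-- The partial action of `R_d / I R_d ⋊ ℤ^d` on `Ω_I`, as the relation
"`x` lies in the domain of `g` and `g.x = y`".  For `g = (b, n)` one wants `y = b + u^n x`.
Clearing denominators, choose `m, k ∈ ℕ^d` and `a ∈ ℤ[u₁,…,u_d] / I` with
`n = k - m` and `u^m b = a`; the equation becomes `u^m y = a + u^k x`, which makes sense in `Ω_I`.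
On `ℤ[u₁,…,u_d] / I` this is the reduction of the affine action on `R_d / I R_d`. -/
def PartialAct (I : Ideal (PolyRing d)) (g : AffGroup I) (x y : Omega I) : Prop :=
  ∃ (m k : Fin d → ℕ) (a : PolyRing d ⧸ I),
    (∀ i, (k i : ℤ) = m i + g.right.toAdd i) ∧
    quotToLaurent I a = quotToLaurent I (Ideal.Quotient.mk I (mono m)) * g.left.toAdd ∧
    completionMap (act I) (Multiplicative.ofAdd m) y =
      toCompletion (act I) a + completionMap (act I) (Multiplicative.ofAdd k) x

theorem polyToLaurent_mono (m : Fin d → ℕ) :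
    polyToLaurent d (mono m) = AddMonoidAlgebra.of ℤ (Fin d → ℤ)
      (Multiplicative.ofAdd (fun i => (m i : ℤ))) := by
  have key : ∀ k : Fin d, polyToLaurent d (MvPolynomial.X k) =
      AddMonoidAlgebra.of ℤ (Fin d → ℤ) (Multiplicative.ofAdd (Pi.single k (1 : ℤ))) := by
    intro k
    simp [polyToLaurent]
  simp only [mono, map_prod, map_pow, key]
  simp only [← map_pow, ← map_prod]
  congr 1
  apply Multiplicative.toAdd.injective
  funext i
  simp [Finset.sum_apply, Pi.single_apply]

theorem quotToLaurent_mono (I : Ideal (PolyRing d)) (m : Fin d → ℕ) :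
    quotToLaurent I (Ideal.Quotient.mk I (mono m)) =
      zmono I (Multiplicative.ofAdd (fun i => (m i : ℤ))) := by
  rw [quotToLaurent, Ideal.quotientMap_mk, polyToLaurent_mono]
  rfl

theorem zmono_shift (I : Ideal (PolyRing d)) (m k : Fin d → ℕ)
    (n : Multiplicative (Fin d → ℤ)) (h : ∀ i, (k i : ℤ) = m i + n.toAdd i) :
    quotToLaurent I (Ideal.Quotient.mk I (mono m)) * zmono I n =
      quotToLaurent I (Ideal.Quotient.mk I (mono k)) := by
  rw [quotToLaurent_mono, quotToLaurent_mono, ← map_mul]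
  congr 1
  apply Multiplicative.toAdd.injective
  funext i
  simp [h i]

theorem partialAct_one (I : Ideal (PolyRing d)) (x : Omega I) : PartialAct I 1 x x :=
  ⟨0, 0, 0, by simp, by simp, by simp⟩

theorem partialAct_mul (I : Ideal (PolyRing d)) {g h : AffGroup I} {x y z : Omega I}
    (hg : PartialAct I g x y) (hh : PartialAct I h y z) : PartialAct I (h * g) x z := by
  obtain ⟨m, k, a, h1, h2, h3⟩ := hg
  obtain ⟨m', k', a', h1', h2', h3'⟩ := hh
  refine ⟨m + m', k + k',
    Ideal.Quotient.mk I (mono m) * a' + Ideal.Quotient.mk I (mono k') * a, ?_, ?_, ?_⟩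
  · intro i
    have e1 := h1 i
    have e2 := h1' i
    simp only [Pi.add_apply, SemidirectProduct.mul_right, toAdd_mul]
    push_cast
    linarith
  · have e := zmono_shift I m' k' h.right h1'
    have e3 : (h * g).left.toAdd = h.left.toAdd + zmono I h.right * g.left.toAdd := rfl
    rw [e3, map_add, map_mul, map_mul, h2, h2', mono_add, map_mul, map_mul, ← e]
    ring
  · have swap : ∀ (p q : Fin d → ℕ) (w : Omega I),
        completionMap (act I) (Multiplicative.ofAdd p)
          (completionMap (act I) (Multiplicative.ofAdd q) w) =
        completionMap (act I) (Multiplicative.ofAdd q)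
          (completionMap (act I) (Multiplicative.ofAdd p) w) := by
      intro p q w
      rw [← completionMap_mul, ← completionMap_mul, mul_comm]
    rw [ofAdd_add, completionMap_mul, h3', map_add, swap, h3, map_add, map_add,
      ← add_assoc, completionMap_toCompletion, completionMap_toCompletion, swap, ofAdd_add,
      ← completionMap_mul, mul_comm]
    simp only [act_apply, toAdd_ofAdd]

theorem partialAct_inv (I : Ideal (PolyRing d)) {g : AffGroup I} {x y : Omega I}
    (hg : PartialAct I g x y) : PartialAct I g⁻¹ y x := by
  obtain ⟨m, k, a, h1, h2, h3⟩ := hg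
  refine ⟨k, m, -a, ?_, ?_, ?_⟩
  · intro i
    have e1 := h1 i
    simp only [SemidirectProduct.inv_right, toAdd_inv, Pi.neg_apply]
    linarith
  · have e := zmono_shift I m k g.right h1
    have e3 : g⁻¹.left.toAdd = zmono I g.right⁻¹ * (-g.left.toAdd) := rfl
    have e4 : zmono I g.right * zmono I g.right⁻¹ = 1 := by
      rw [← map_mul, mul_inv_cancel, map_one]
    rw [e3, map_neg, h2, ← e]
    linear_combination (quotToLaurent I (Ideal.Quotient.mk I (mono m)) * g.left.toAdd) * e4
  · rw [h3, map_neg]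
    abel

/-- The transformation groupoid `(R_d / I R_d ⋊ ℤ^d) ⋉ Ω_I`: the unit space is `Ω_I`, the arrows
from `x` to `y` are the `g` with `g.x = y`, and `h` after `g` is `h g`. -/
instance groupoid (I : Ideal (PolyRing d)) : Groupoid.{0} (Omega I) where
  Hom x y := {g : AffGroup I // PartialAct I g x y}
  id x := ⟨1, partialAct_one I x⟩
  comp f g := ⟨g.1 * f.1, partialAct_mul I f.2 g.2⟩
  inv f := ⟨f.1⁻¹, partialAct_inv I f.2⟩
  id_comp _ := Subtype.ext (mul_one _)
  comp_id _ := Subtype.ext (one_mul _)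
  assoc _ _ _ := Subtype.ext (mul_assoc _ _ _).symm
  inv_comp _ := Subtype.ext (mul_inv_cancel _)
  comp_inv _ := Subtype.ext (inv_mul_cancel _)

/-- The topology on the arrows `(g, x)`: the one induced from the product of the discrete group
`R_d / I R_d ⋊ ℤ^d` and `Ω_I`. -/
instance arrowTopology (I : Ideal (PolyRing d)) : TopologicalSpace (Arrows (Omega I)) :=
  TopologicalSpace.induced (fun a => ((a.2.2.1, a.1) : AffGroup I × Omega I))
    (@instTopologicalSpaceProd (AffGroup I) (Omega I) ⊥ (completionTopology (act I)))

end Ideals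

end AlgAct

end

open scoped TensorProduct
open CategoryTheory

noncomputable section

/-! Write A and A' for the two quotient rings. By (b) and (c), each u_k and some u^n - 1 are
non-zero at every complex point. In a torsion-free ring finite over ℤ they are therefore
non-zero-divisors, and multiplication by them has finite index. This gives injectivity of A into its
Laurent localization, compactness of the completion, and freeness in the choice of finite-index
subgroups.

From groupoids to actions, an isomorphism is a homeomorphism of unit spaces with a locally constant
cocycle κ. Compactness and finite generation of A give one modulus u^l A for κ on all translations
(`exists_tr_uniform`), so a ↦ κ(u^l a, 0) is a group homomorphism. The dilations u^n fix 0, and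
their relation with translations makes this homomorphism equivariant; since u^n - 1 is a
non-zero-divisor for some n, it takes values in translations (`germ_right`). Clearing denominators
gives an injective χ : A → A', equivariant over a homomorphism `shift` : ℕ^d → ℤ^e
(`exists_equivariant`). The inverse isomorphism gives the same in the other direction, so the ranks
agree.

Two facts make `shift` an isomorphism ℕ^d ≅ ℕ^e. Comparing determinants along χ, a prime from (d)
rules out negative coordinates (`shift_nonneg`). The lattice part of κ stays within bounded distance
of `shift` (`exists_bound`), so the shifts of the two cocycles are mutually inverse, a bounded
additive discrepancy being zero. Finally χ has finite index, so the substitution u^n ↦ u^{shift n}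
carries one ideal into the other (`polyMap_mem_of_equivariant`), giving a ring isomorphism that
matches monomials.

From actions to groupoids, the same argument with χ replaced by the given group isomorphism yields
such a ring isomorphism; all ingredients of the groupoid are functorial in it. -/

namespace AlgAct

/-! ### Finite-index images in finitely generated torsion-free groups. -/

section FiniteTorsionFree

variable {A B : Type} [AddCommGroup A] [AddCommGroup B]

/-- An injective homomorphism between finitely generated torsion-free abelian groups of the same
rank has image of finite index. -/
theorem finite_quotient_range [Module.Finite ℤ A] [IsAddTorsionFree A] [Module.Finite ℤ B]
    [IsAddTorsionFree B] (f : A →+ B) (hf : Function.Injective f)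
    (h : Module.finrank ℤ A = Module.finrank ℤ B) : Finite (B ⧸ f.range) := by
  have e : Finite (B ⧸ LinearMap.range f.toIntLinearMap) :=
    Submodule.finiteQuotientOfFreeOfRankEq _ (by
      rw [← h]; exact LinearMap.finrank_range_of_inj hf)
  exact e

/-- The index of the image serves as N. This extends identities with values in a torsion-free group
from a finite-index subgroup to the whole group. -/
theorem exists_smul_mem_range [Module.Finite ℤ A] [IsAddTorsionFree A] [Module.Finite ℤ B]
    [IsAddTorsionFree B] (f : A →+ B) (hf : Function.Injective f)
    (h : Module.finrank ℤ A = Module.finrank ℤ B) :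
    ∃ N : ℕ, N ≠ 0 ∧ ∀ b : B, ∃ a : A, f a = N • b := by
  have := finite_quotient_range f hf h
  refine ⟨f.range.index, ?_, fun b => f.range.nsmul_index_mem b⟩
  exact Nat.card_pos.ne'

theorem smul_eq_zero_of_torsionFree [IsAddTorsionFree A] {N : ℕ} (hN : N ≠ 0) {a : A}
    (h : N • a = 0) : a = 0 := by
  simpa [hN] using h

theorem exists_finset_closure_eq_top [Module.Finite ℤ A] :
    ∃ s : Finset A, AddSubgroup.closure (s : Set A) = ⊤ :=
  AddGroup.fg_def.1 (Module.Finite.iff_addGroup_fg.1 inferInstance)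

end FiniteTorsionFree

/-! ### Extending additive maps from ℕ^d to ℤ^d. -/

section ExtendInt

variable {d : ℕ} {B : Type} [AddCommGroup B] (s : (Fin d → ℕ) →+ B)

theorem eq_sum_smul_single (n : Fin d → ℕ) :
    n = ∑ j, n j • (Pi.single j 1 : Fin d → ℕ) := by
  funext i
  simp [Finset.sum_apply, Pi.single_apply]

/-- The extension of an additive map on `ℕ^d` to `ℤ^d`. -/
def extendInt : (Fin d → ℤ) →+ B where
  toFun z := ∑ j, z j • s (Pi.single j 1)
  map_zero' := by simp
  map_add' x y := by simp [add_smul, Finset.sum_add_distrib]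

theorem extendInt_natCast (n : Fin d → ℕ) : extendInt s (fun i => (n i : ℤ)) = s n := by
  conv_rhs => rw [eq_sum_smul_single n, map_sum]
  simp only [map_nsmul, extendInt, AddMonoidHom.coe_mk, ZeroHom.coe_mk, natCast_zsmul]

theorem exists_eq_sub_natCast (z : Fin d → ℤ) :
    ∃ m k : Fin d → ℕ, z = (fun i => (k i : ℤ)) - fun i => (m i : ℤ) :=
  ⟨fun i => (-(z i)).toNat, fun i => (z i).toNat, by
    funext i
    simp only [Pi.sub_apply]
    omega⟩

end ExtendInt

/-! ### Non-zero-divisors from complex points, and norms. -/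

section Ring

variable {R : Type} [CommRing R]

/-- An element that is non-zero at all complex points of a torsion-free ring, finite over `ℤ`, is
a non-zero-divisor. -/
theorem mem_nonZeroDivisors_of_complexPoints [Module.Finite ℤ R] [IsAddTorsionFree R] (a : R)
    (h : ∀ ψ : R →+* ℂ, ψ a ≠ 0) : a ∈ nonZeroDivisors R := by
  rw [mem_nonZeroDivisors_iff_right]
  intro b hab
  by_contra hb
  -- By torsion-freeness the annihilator of a non-zero `b` contains no non-zero integer. A prime
  -- above it with the same property gives a domain finite over ℤ in which ℤ embeds; this maps to ℂ,
  -- and the resulting point kills `a`.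
  let J : Ideal R := Ideal.span {b} |>.annihilator
  have hJ : ∀ r, r ∈ J ↔ r * b = 0 := fun r => by
    simp [J]
  obtain ⟨P, hP, hJP, hd⟩ := Ideal.exists_le_prime_disjoint J
    ((nonZeroDivisors ℤ).map (algebraMap ℤ R)) (by
      rw [Set.disjoint_left]
      rintro _ hx ⟨n, hn, rfl⟩
      have hx' := (hJ _).1 hx
      have hn0 : n ≠ 0 := nonZeroDivisors.ne_zero hn
      apply hb
      have h1 : n • b = 0 := by rw [zsmul_eq_mul]; simpa using hx'
      exact (smul_eq_zero.1 h1).resolve_left hn0)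
  have hinj : Function.Injective (algebraMap ℤ (R ⧸ P)) := by
    rw [injective_iff_map_eq_zero]
    intro n hn
    by_contra hn0
    have hmem : algebraMap ℤ R n ∈ P := Ideal.Quotient.eq_zero_iff_mem.1 (by simpa using hn)
    exact Set.disjoint_left.1 hd hmem ⟨n, mem_nonZeroDivisors_of_ne_zero hn0, rfl⟩
  have : FaithfulSMul ℤ (R ⧸ P) := (faithfulSMul_iff_algebraMap_injective ℤ (R ⧸ P)).2 hinj
  have : Module.Finite ℤ (R ⧸ P) := Module.Finite.of_surjective
    (Ideal.Quotient.mkₐ ℤ P).toLinearMap Ideal.Quotient.mk_surjective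
  let ψ : R ⧸ P →ₐ[ℤ] ℂ := IsAlgClosed.lift
  refine h (ψ.toRingHom.comp (Ideal.Quotient.mk P)) ?_
  have : Ideal.Quotient.mk P a = 0 :=
    Ideal.Quotient.eq_zero_iff_mem.2 (hJP ((hJ a).2 ((mul_comm a b).trans hab)))
  simp [this]

/-- The determinant of multiplication by `a`. -/
def mulDet (a : R) : ℤ := LinearMap.det (LinearMap.mulLeft ℤ a)

theorem mulDet_mul (a b : R) : mulDet (a * b) = mulDet a * mulDet b := by
  rw [mulDet, LinearMap.mulLeft_mul, ← Module.End.mul_eq_comp, map_mul]; rfl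

theorem mulDet_one : mulDet (1 : R) = 1 := by
  rw [mulDet, LinearMap.mulLeft_one, LinearMap.det_id]

/-- The ring is free over ℤ, so the determinant commutes with base change to ℚ; divisibility of
norms becomes divisibility of integers. -/
theorem absNorm_eq [Module.Finite ℤ R] [IsAddTorsionFree R] (a : R) :
    absNorm a = |(mulDet a : ℚ)| := by
  rw [absNorm, LinearMap.det_baseChange]; rfl

theorem dvd_mulDet_iff [Module.Finite ℤ R] [IsAddTorsionFree R] (a : R) (p : ℕ) :
    (∃ c : ℤ, absNorm a = p * c) ↔ (p : ℤ) ∣ mulDet a := by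
  rw [absNorm_eq, ← dvd_abs]
  constructor
  · rintro ⟨c, hc⟩
    exact ⟨c, by exact_mod_cast hc⟩
  · rintro ⟨c, hc⟩
    exact ⟨c, by exact_mod_cast hc⟩

end Ring

/-! ### Algebraic consequences of the hypotheses, and the Laurent quotient. -/

section Admissible

variable {d : ℕ}

/-- The properties of an ideal that the rigidity theorem uses. -/
structure Admissible (I : Ideal (PolyRing d)) : Prop where
  finite : Module.Finite ℤ (PolyRing d ⧸ I)
  torsionFree : IsAddTorsionFree (PolyRing d ⧸ I)
  udot_mem : ∀ k, udot I k ∈ nonZeroDivisors (PolyRing d ⧸ I)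
  exists_sub_one_mem : ∃ n : Fin d → ℕ,
    Ideal.Quotient.mk I (mono n) - 1 ∈ nonZeroDivisors (PolyRing d ⧸ I)
  exists_prime : ∀ j, ∃ p : ℕ, p.Prime ∧ (p : ℤ) ∣ mulDet (udot I j) ∧
    ∀ k, k ≠ j → ¬ (p : ℤ) ∣ mulDet (udot I k)

theorem complexPoint_mem_variety (I : Ideal (PolyRing d)) (ψ : PolyRing d ⧸ I →+* ℂ) :
    (fun k => ψ (udot I k)) ∈ variety I ∧
      ∀ f, ψ (Ideal.Quotient.mk I f) = MvPolynomial.aeval (fun k => ψ (udot I k)) f := by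
  have key : ∀ f, ψ (Ideal.Quotient.mk I f) =
      MvPolynomial.aeval (fun k => ψ (udot I k)) f := by
    intro f
    have : (ψ.comp (Ideal.Quotient.mk I)).toIntAlgHom =
        MvPolynomial.aeval (fun k => ψ (udot I k)) := by
      apply MvPolynomial.algHom_ext
      intro k
      rw [MvPolynomial.aeval_X]
      rfl
    exact DFunLike.congr_fun this f
  refine ⟨fun f hf => ?_, key⟩
  rw [← key, Ideal.Quotient.eq_zero_iff_mem.2 hf, map_zero]

theorem admissible_of_hypotheses (I : Ideal (PolyRing d))
    (hfin : Module.Finite ℤ (PolyRing d ⧸ I)) (htf : IsAddTorsionFree (PolyRing d ⧸ I))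
    (hb : ∀ z ∈ variety I, ∀ k, z k ≠ 0)
    (hc : ∃ n : Fin d → ℕ, ∀ z ∈ variety I, MvPolynomial.aeval z (mono n) ≠ 1)
    (hd : ∀ j : Fin d, ∃ p : ℕ, p.Prime ∧ (∃ c : ℤ, absNorm (udot I j) = p * c) ∧
      ∀ k : Fin d, k ≠ j → ¬ ∃ c : ℤ, absNorm (udot I k) = p * c) : Admissible I where
  finite := hfin
  torsionFree := htf
  udot_mem k := mem_nonZeroDivisors_of_complexPoints _
    fun ψ => hb _ (complexPoint_mem_variety I ψ).1 k
  exists_sub_one_mem := by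
    obtain ⟨n, hn⟩ := hc
    refine ⟨n, mem_nonZeroDivisors_of_complexPoints _ fun ψ h => ?_⟩
    obtain ⟨h1, h2⟩ := complexPoint_mem_variety I ψ
    refine hn _ h1 ?_
    rw [map_sub, map_one, h2] at h
    exact sub_eq_zero.1 h
  exists_prime j := by
    obtain ⟨p, hp, h1, h2⟩ := hd j
    refine ⟨p, hp, (dvd_mulDet_iff _ _).1 h1, fun k hk h => h2 k hk ((dvd_mulDet_iff _ _).2 h)⟩

/-- The class of the monomial `u^n`. -/
def mbar (I : Ideal (PolyRing d)) (n : Fin d → ℕ) : PolyRing d ⧸ I := Ideal.Quotient.mk I (mono n)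

variable (I : Ideal (PolyRing d))

theorem mbar_zero : mbar I 0 = 1 := by rw [mbar, mono_zero, map_one]

theorem mbar_add (m n : Fin d → ℕ) : mbar I (m + n) = mbar I m * mbar I n := by
  rw [mbar, mono_add, map_mul]; rfl

theorem mbar_eq_prod (n : Fin d → ℕ) : mbar I n = ∏ k, udot I k ^ n k := by
  simp [mbar, mono, udot]

theorem mbar_single (j : Fin d) : mbar I (Pi.single j 1) = udot I j := by
  rw [mbar_eq_prod, Finset.prod_eq_single j]
  · simp
  · intro k _ hk; simp [hk]
  · simp

theorem mulDet_mbar (n : Fin d → ℕ) :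
    mulDet (mbar I n) = ∏ k, mulDet (udot I k) ^ n k := by
  let D : PolyRing d ⧸ I →* ℤ := ⟨⟨mulDet, mulDet_one⟩, mulDet_mul⟩
  have : D (mbar I n) = ∏ k, D (udot I k) ^ n k := by
    rw [mbar_eq_prod, map_prod]; simp
  exact this

variable {I}

theorem Admissible.mbar_mem (h : Admissible I) (n : Fin d → ℕ) :
    mbar I n ∈ nonZeroDivisors (PolyRing d ⧸ I) := by
  rw [mbar_eq_prod]
  exact prod_mem fun k _ => pow_mem (h.udot_mem k) _

theorem Admissible.mbar_cancel (h : Admissible I) {n : Fin d → ℕ} {x y : PolyRing d ⧸ I}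
    (hxy : mbar I n * x = mbar I n * y) : x = y :=
  (mul_cancel_left_mem_nonZeroDivisors (h.mbar_mem n)).1 hxy

/-! ### The Laurent quotient as a localization -/

theorem zmono_natCast (n : Fin d → ℕ) :
    zmono I (Multiplicative.ofAdd (fun i => (n i : ℤ))) = quotToLaurent I (mbar I n) :=
  (quotToLaurent_mono I n).symm

theorem isUnit_zmono (n : Multiplicative (Fin d → ℤ)) : IsUnit (zmono I n) :=
  (Group.isUnit n).map (zmono I)

/-- The monomials are non-zero-divisors, hence units in the total fraction ring K. The embedding of
the quotient ring in K therefore factors through the Laurent quotient. -/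
theorem Admissible.quotToLaurent_injective (h : Admissible I) :
    Function.Injective (quotToLaurent I) := by
  let K := FractionRing (PolyRing d ⧸ I)
  have hu : ∀ k, IsUnit (algebraMap _ K (udot I k)) := fun k =>
    IsLocalization.map_units K ⟨udot I k, h.udot_mem k⟩
  choose w hw using hu
  let Z : Multiplicative (Fin d → ℤ) →* K :=
    (Units.coeHom K).comp
      { toFun := fun n => ∏ k, w k ^ n.toAdd k
        map_one' := by simp
        map_mul' := fun m n => by simp [zpow_add, Finset.prod_mul_distrib] }
  let Φ : Laurent d →ₐ[ℤ] K := AddMonoidAlgebra.lift ℤ K (Fin d → ℤ) Z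
  have key : ∀ f, Φ (polyToLaurent d f) = algebraMap _ K (Ideal.Quotient.mk I f) := by
    intro f
    have : Φ.toRingHom.comp (polyToLaurent d) =
        (algebraMap _ K).comp (Ideal.Quotient.mk I) := by
      refine MvPolynomial.ringHom_ext (fun c => by simp) fun k => ?_
      have hs : (∏ i, w i ^ (Pi.single k (1 : ℤ) : Fin d → ℤ) i) = w k := by
        rw [Finset.prod_eq_single k]
        · simp
        · intro i _ hi; simp [hi]
        · simp
      have hk : (algebraMap _ K) (Ideal.Quotient.mk I (MvPolynomial.X k)) = (w k : K) :=
        (hw k).symm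
      simp only [RingHom.comp_apply, hk]
      simp [polyToLaurent, Φ, AddMonoidAlgebra.lift_single, Z, hs]
      rw [Algebra.smul_def, map_one, one_mul]
    exact DFunLike.congr_fun this f
  have hle : laurentIdeal I ≤ RingHom.ker Φ.toRingHom := by
    rw [laurentIdeal, Ideal.map_le_iff_le_comap]
    intro f hf
    have : Φ (polyToLaurent d f) = 0 := by
      rw [key, Ideal.Quotient.eq_zero_iff_mem.2 hf, map_zero]
    exact this
  let Ψ : LaurentQuot I →+* K := Ideal.Quotient.lift _ Φ.toRingHom hle
  have hΨ : ∀ a, Ψ (quotToLaurent I a) = algebraMap _ K a := by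
    intro a
    obtain ⟨f, rfl⟩ := Ideal.Quotient.mk_surjective a
    exact key f
  intro a b hab
  apply IsFractionRing.injective (PolyRing d ⧸ I) K
  rw [← hΨ, ← hΨ, hab]

/-- Monomials suffice as denominators: for a single Laurent monomial the negative part of its
exponent works, and sums use the product of the denominators. -/
theorem exists_mbar_mul_eq (b : LaurentQuot I) :
    ∃ (m : Fin d → ℕ) (a : PolyRing d ⧸ I),
      quotToLaurent I a = quotToLaurent I (mbar I m) * b := by
  obtain ⟨f, rfl⟩ := Ideal.Quotient.mk_surjective b
  induction f using AddMonoidAlgebra.induction_linear with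
  | zero => exact ⟨0, 0, by simp⟩
  | add f g hf hg =>
    obtain ⟨m, a, h1⟩ := hf
    obtain ⟨n, b, h2⟩ := hg
    refine ⟨m + n, mbar I n * a + mbar I m * b, ?_⟩
    rw [map_add, map_mul, map_mul, h1, h2, mbar_add, map_mul, map_add]
    ring
  | single n c =>
    refine ⟨fun i => (-(n i)).toNat, c * mbar I (fun i => (n i).toNat), ?_⟩
    have h1 : Ideal.Quotient.mk (laurentIdeal I) (AddMonoidAlgebra.single n c) =
        c * zmono I (Multiplicative.ofAdd n) := by
      have : (AddMonoidAlgebra.single n c : Laurent d) =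
          c * AddMonoidAlgebra.of ℤ (Fin d → ℤ) (Multiplicative.ofAdd n) := by
        rw [← zsmul_eq_mul]; simp
      rw [this, map_mul, map_intCast]; rfl
    rw [h1, map_mul, map_intCast, ← zmono_natCast, ← zmono_natCast, mul_left_comm, ← map_mul]
    congr 2
    apply Multiplicative.toAdd.injective
    funext i
    simp
    omega

theorem Admissible.laurentQuot_torsionFree (h : Admissible I) {N : ℕ} (hN : N ≠ 0)
    {b : LaurentQuot I} (hb : N • b = 0) : b = 0 := by
  have := h.torsionFree
  obtain ⟨m, a, h1⟩ := exists_mbar_mul_eq b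
  have h2 : quotToLaurent I (N • a) = 0 := by
    rw [map_nsmul, h1, ← mul_smul_comm, hb, mul_zero]
  have h3 : a = 0 := smul_eq_zero_of_torsionFree hN
    (h.quotToLaurent_injective (by rw [h2, map_zero]))
  rw [h3, map_zero, ← zmono_natCast] at h1
  exact ((isUnit_zmono _).mul_right_eq_zero).1 h1.symm

end Admissible

/-! ### The topology of the completion through congruences modulo u^n A. -/

section OmegaTopology

variable {d : ℕ} (I : Ideal (PolyRing d))

/-- The constructible subgroup `u^n A`. -/
def mulSubgroup (n : Fin d → ℕ) : Constructible (act I) :=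
  ⟨AddSubgroup.map (endo (act I) (Multiplicative.ofAdd n)) ⊤, .image _ _ .whole⟩

theorem mem_mulSubgroup {n : Fin d → ℕ} {a : PolyRing d ⧸ I} :
    a ∈ (mulSubgroup I n).1 ↔ ∃ b, mbar I n * b = a :=
  ⟨fun ⟨b, _, h⟩ => ⟨b, h⟩, fun ⟨b, h⟩ => ⟨b, trivial, h⟩⟩

theorem mulSubgroup_add_le (m n : Fin d → ℕ) :
    (mulSubgroup I (m + n)).1 ≤ (mulSubgroup I m).1 := by
  intro a ha
  obtain ⟨b, rfl⟩ := (mem_mulSubgroup I).1 ha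
  exact (mem_mulSubgroup I).2 ⟨mbar I n * b, by rw [mbar_add, mul_assoc]⟩

theorem mulSubgroup_mono {m n : Fin d → ℕ} (h : m ≤ n) :
    (mulSubgroup I n).1 ≤ (mulSubgroup I m).1 := by
  obtain ⟨k, rfl⟩ := exists_add_of_le h
  exact mulSubgroup_add_le I m k

/-- The subgroups u^n A are cofinal among the constructible ones: an image under u^s replaces n by s
+ n, and by commutativity a preimage still contains u^n A. Hence congruence modulo u^n A controls
the inverse limit. -/
theorem exists_mulSubgroup_le {C : AddSubgroup (PolyRing d ⧸ I)} (hC : IsConstructible (act I) C) :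
    ∃ n, (mulSubgroup I n).1 ≤ C := by
  induction hC with
  | whole => exact ⟨0, le_top⟩
  | image s C _ ih =>
    obtain ⟨n, hn⟩ := ih
    refine ⟨s.toAdd + n, fun a ha => ?_⟩
    obtain ⟨b, rfl⟩ := (mem_mulSubgroup I).1 ha
    exact ⟨mbar I n * b, hn ((mem_mulSubgroup I).2 ⟨b, rfl⟩), by
      rw [mbar_add, mul_assoc]; rfl⟩
  | preimage s C _ ih =>
    obtain ⟨n, hn⟩ := ih
    refine ⟨n, fun a ha => ?_⟩
    obtain ⟨b, rfl⟩ := (mem_mulSubgroup I).1 ha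
    exact hn ((mem_mulSubgroup I).2 ⟨mbar I s.toAdd * b, mul_left_comm _ _ _⟩)

/-- Two elements of `Ω_I` are congruent modulo (the closure of) `u^n A`. -/
def Cong (n : Fin d → ℕ) (x y : Omega I) : Prop := x.1 (mulSubgroup I n) = y.1 (mulSubgroup I n)

variable {I}

theorem Cong.symm {n : Fin d → ℕ} {x y : Omega I} (h : Cong I n x y) : Cong I n y x := Eq.symm h

theorem Cong.trans {n : Fin d → ℕ} {x y z : Omega I} (h : Cong I n x y) (h' : Cong I n y z) :
    Cong I n x z := Eq.trans h h'

theorem apply_eq_of_cong {n : Fin d → ℕ} {x y : Omega I} (h : Cong I n x y)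
    (C : Constructible (act I)) (hC : (mulSubgroup I n).1 ≤ C.1) : x.1 C = y.1 C := by
  rw [← x.2 _ C hC, ← y.2 _ C hC, h]

theorem Cong.mono {m n : Fin d → ℕ} {x y : Omega I} (h : Cong I n x y) (hmn : m ≤ n) :
    Cong I m x y := apply_eq_of_cong h _ (mulSubgroup_mono I hmn)

theorem Cong.add_left {n : Fin d → ℕ} {x y : Omega I} (h : Cong I n x y) (z : Omega I) :
    Cong I n (z + x) (z + y) := by
  change z.1 _ + x.1 _ = z.1 _ + y.1 _
  rw [h]

variable (I) in
/-- The canonical map `A → Ω_I`. -/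
abbrev toOmega : PolyRing d ⧸ I →+ Omega I := toCompletion (act I)

variable (I) in
/-- Multiplication by `u^n` on `Ω_I`. -/
abbrev mulOmega (n : Fin d → ℕ) : Omega I →+ Omega I :=
  completionMap (act I) (Multiplicative.ofAdd n)

theorem cong_toOmega {n : Fin d → ℕ} {a b : PolyRing d ⧸ I} :
    Cong I n (toOmega I a) (toOmega I b) ↔ ∃ c, mbar I n * c = -a + b :=
  QuotientAddGroup.eq.trans (mem_mulSubgroup I)

theorem cong_zero_toOmega_mul (n : Fin d → ℕ) (a : PolyRing d ⧸ I) :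
    Cong I n 0 (toOmega I (mbar I n * a)) := by
  rw [← map_zero (toOmega I)]
  exact cong_toOmega.2 ⟨a, by simp⟩

theorem exists_cong_toOmega (n : Fin d → ℕ) (x : Omega I) : ∃ a, Cong I n x (toOmega I a) := by
  obtain ⟨a, ha⟩ := QuotientAddGroup.mk_surjective (x.1 (mulSubgroup I n))
  exact ⟨a, ha.symm⟩

theorem Admissible.mulOmega_injective (h : Admissible I) (m : Fin d → ℕ) :
    Function.Injective (mulOmega I m) := by
  rw [injective_iff_map_eq_zero]
  intro x hx
  apply Subtype.ext
  funext C
  -- The component of x at C can be read off from that of u^m x at u^m C, because the preimage of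
  -- u^m C lies in C by cancellation.
  let D : Constructible (act I) := ⟨_, .image (Multiplicative.ofAdd m) C.1 C.2⟩
  have hle : (pre (act I) (Multiplicative.ofAdd m) D).1 ≤ C.1 := by
    rintro a ⟨b, hb, hab⟩
    have : b = a := h.mbar_cancel hab
    exact this ▸ hb
  obtain ⟨a, ha⟩ := QuotientAddGroup.mk_surjective
    (x.1 (pre (act I) (Multiplicative.ofAdd m) D))
  have h1 := completionMap_apply (act I) _ x D a ha.symm
  have h2 : (completionMap (act I) (Multiplicative.ofAdd m) x).1 D = 0 := by
    have : completionMap (act I) (Multiplicative.ofAdd m) x = 0 := hx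
    rw [this]; rfl
  rw [h2] at h1
  have h3 : a ∈ (pre (act I) (Multiplicative.ofAdd m) D).1 :=
    (QuotientAddGroup.eq_zero_iff (N := D.1) _).1 h1.symm
  rw [← x.2 _ C hle, ← ha]
  exact (QuotientAddGroup.eq_zero_iff _).2 (hle h3)

theorem Admissible.finite_quotient (h : Admissible I) (C : Constructible (act I)) :
    Finite ((PolyRing d ⧸ I) ⧸ C.1) := by
  obtain ⟨n, hn⟩ := exists_mulSubgroup_le I C.2
  have := h.finite
  have := h.torsionFree
  have h1 : Finite ((PolyRing d ⧸ I) ⧸ (AddMonoidHom.mulLeft (mbar I n)).range) :=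
    finite_quotient_range _ (fun _ _ => h.mbar_cancel) rfl
  have h2 : (AddMonoidHom.mulLeft (mbar I n)).range ≤ C.1 := by
    rintro _ ⟨b, rfl⟩
    exact hn ((mem_mulSubgroup I).2 ⟨b, rfl⟩)
  refine Finite.of_surjective (proj h2) fun y => ?_
  obtain ⟨a, rfl⟩ := QuotientAddGroup.mk_surjective y
  exact ⟨a, rfl⟩

theorem Admissible.compactSpace (h : Admissible I) :
    @CompactSpace (Omega I) (completionTopology (act I)) := by
  let : ∀ C : Constructible (act I), TopologicalSpace ((PolyRing d ⧸ I) ⧸ C.1) := fun _ => ⊥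
  have : ∀ C : Constructible (act I), DiscreteTopology ((PolyRing d ⧸ I) ⧸ C.1) := fun _ => ⟨rfl⟩
  have := h.finite_quotient
  have hcl : IsClosed (completionSubgroup (act I) : Set (∀ C : Constructible (act I),
      (PolyRing d ⧸ I) ⧸ C.1)) := by
    have : (completionSubgroup (act I) : Set (∀ C : Constructible (act I),
        (PolyRing d ⧸ I) ⧸ C.1)) =
        ⋂ (C : Constructible (act I)) (D : Constructible (act I)) (h : C.1 ≤ D.1),
          {x | proj h (x C) = x D} := by
      ext x
      simp only [Set.mem_iInter]
      rfl
    rw [this]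
    refine isClosed_iInter fun C => isClosed_iInter fun D => isClosed_iInter fun hCD => ?_
    exact isClosed_eq (continuous_of_discreteTopology.comp (continuous_apply C))
      (continuous_apply D)
  exact isCompact_iff_compactSpace.1 hcl.isCompact

theorem isOpen_setOf_cong (n : Fin d → ℕ) (x : Omega I) :
    @IsOpen _ (completionTopology (act I)) {y | Cong I n x y} := by
  let : ∀ C : Constructible (act I), TopologicalSpace ((PolyRing d ⧸ I) ⧸ C.1) := fun _ => ⊥
  have : ∀ C : Constructible (act I), DiscreteTopology ((PolyRing d ⧸ I) ⧸ C.1) := fun _ => ⟨rfl⟩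
  exact ⟨{z | x.1 (mulSubgroup I n) = z (mulSubgroup I n)},
    (isOpen_discrete {a | x.1 (mulSubgroup I n) = a}).preimage (continuous_apply _), rfl⟩

theorem exists_cong_subset {U : Set (Omega I)} (hU : @IsOpen _ (completionTopology (act I)) U)
    {x : Omega I} (hx : x ∈ U) : ∃ n, ∀ y, Cong I n x y → y ∈ U := by
  let : ∀ C : Constructible (act I), TopologicalSpace ((PolyRing d ⧸ I) ⧸ C.1) := fun _ => ⊥
  obtain ⟨V, hV, rfl⟩ := hU
  obtain ⟨s, u, hu, hsub⟩ := isOpen_pi_iff.1 hV _ hx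
  choose n hn using fun C : Constructible (act I) => exists_mulSubgroup_le I C.2
  -- The sum of the finitely many levels dominates each of them, so congruence at the sum implies
  -- all the required ones.
  refine ⟨∑ C ∈ s, n C, fun y hy => hsub fun C hC => ?_⟩
  have : x.1 C = y.1 C := apply_eq_of_cong hy C
    ((mulSubgroup_mono I (Finset.single_le_sum (f := n) (fun _ _ => zero_le) hC)).trans (hn C))
  have hxu : x.1 C ∈ u C := (hu C hC).2
  rw [this] at hxu
  exact hxu

/-- A locally constant function on `Ω_I` factors through some `A / u^n A`. -/
theorem Admissible.exists_uniform {X : Type} (h : Admissible I) (f : Omega I → X)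
    (hf : ∀ x, ∃ n, ∀ y, Cong I n x y → f y = f x) :
    ∃ n, ∀ x y, Cong I n x y → f y = f x := by
  let := completionTopology (act I)
  have := h.compactSpace
  choose n hn using hf
  obtain ⟨t, ht⟩ := isCompact_univ.elim_finite_subcover (fun x => {y | Cong I (n x) x y})
    (fun x => isOpen_setOf_cong (n x) x) (fun x _ => Set.mem_iUnion.2 ⟨x, rfl⟩)
  refine ⟨∑ x ∈ t, n x, fun x y hxy => ?_⟩
  obtain ⟨z, hz, hzx⟩ := Set.mem_iUnion₂.1 (ht (Set.mem_univ x))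
  have hxy' : Cong I (n z) x y :=
    hxy.mono (Finset.single_le_sum (f := n) (fun _ _ => zero_le) hz)
  rw [hn z x hzx, hn z y (Cong.trans hzx hxy')]

end OmegaTopology

/-! ### Translations and dilations in the affine group. -/

section AffineGroup

variable {d : ℕ} (I : Ideal (PolyRing d))

/-- The translation by `a ∈ A`, as an element of `R_d / I R_d ⋊ ℤ^d`. -/
def translation (a : PolyRing d ⧸ I) : AffGroup I :=
  SemidirectProduct.inl (Multiplicative.ofAdd (quotToLaurent I a))

/-- The multiplication by `u^n`, as an element of `R_d / I R_d ⋊ ℤ^d`. -/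
def dilation (n : Fin d → ℕ) : AffGroup I :=
  SemidirectProduct.inr (Multiplicative.ofAdd (fun i => (n i : ℤ)))

theorem translation_zero : translation I 0 = 1 := by
  simp [translation]

theorem translation_add (a b : PolyRing d ⧸ I) :
    translation I (a + b) = translation I a * translation I b := by
  simp [translation]

theorem dilation_add (m n : Fin d → ℕ) :
    dilation I (m + n) = dilation I m * dilation I n := by
  rw [dilation, dilation, dilation, ← map_mul, ← ofAdd_add]
  congr 2

theorem dilation_right (n : Fin d → ℕ) :
    zmono I (dilation I n).right = quotToLaurent I (mbar I n) := zmono_natCast n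

theorem dilation_mul_translation (n : Fin d → ℕ) (a : PolyRing d ⧸ I) :
    dilation I n * translation I a = translation I (mbar I n * a) * dilation I n := by
  refine SemidirectProduct.ext ?_ ?_
  · apply Multiplicative.toAdd.injective
    change 0 + zmono I (dilation I n).right * quotToLaurent I a =
      quotToLaurent I (mbar I n * a) + zmono I _ * 0
    rw [dilation_right, map_mul]
    simp
  · simp [dilation, translation]

variable {I}

theorem partialAct_translation (a : PolyRing d ⧸ I) (x : Omega I) :
    PartialAct I (translation I a) x (toOmega I a + x) :=
  ⟨0, 0, a, by simp [translation], by
    rw [mono_zero, map_one, map_one, one_mul]; rfl, by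
    rw [ofAdd_zero, completionMap_one, completionMap_one]⟩

theorem partialAct_dilation (n : Fin d → ℕ) (x : Omega I) :
    PartialAct I (dilation I n) x (mulOmega I n x) :=
  ⟨0, n, 0, by simp [dilation], by
    simp [dilation], by
    rw [ofAdd_zero, completionMap_one, map_zero, zero_add]⟩

/-- Clearing denominators inside the group: this expresses the cocycle at an arbitrary element
through its values on translations and dilations, which are defined everywhere. -/
theorem PartialAct.exists_factorization {g : AffGroup I} {x y : Omega I}
    (h : PartialAct I g x y) : ∃ (m k : Fin d → ℕ) (a : PolyRing d ⧸ I),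
      (∀ i, (k i : ℤ) = m i + g.right.toAdd i) ∧
      dilation I m * g = translation I a * dilation I k ∧
      mulOmega I m y = toOmega I a + mulOmega I k x := by
  obtain ⟨m, k, a, h1, h2, h3⟩ := h
  refine ⟨m, k, a, h1, SemidirectProduct.ext ?_ ?_, h3⟩
  · apply Multiplicative.toAdd.injective
    change 0 + zmono I (dilation I m).right * g.left.toAdd = quotToLaurent I a + zmono I _ * 0
    rw [h2, dilation_right]
    simp [mbar]
  · apply Multiplicative.toAdd.injective
    funext i
    simp [dilation, translation, h1 i]

/-- Composing one arrow with the inverse of the other reduces to g = 1. There a = 0 and m = k, and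
multiplication by u^m is injective on the completion. -/
theorem Admissible.partialAct_unique (hI : Admissible I) {g : AffGroup I} {x y z : Omega I}
    (h : PartialAct I g x y) (h' : PartialAct I g x z) : y = z := by
  have h1 := partialAct_mul I (partialAct_inv I h) h'
  rw [mul_inv_cancel] at h1
  obtain ⟨m, k, a, e1, e2, e3⟩ := h1
  have hmk : m = k := by
    funext i
    have := e1 i
    simp at this
    exact this.symm
  have ha : a = 0 := hI.quotToLaurent_injective (by rw [e2]; simp)
  rw [ha, map_zero, zero_add, ← hmk] at e3
  exact (hI.mulOmega_injective m e3).symm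

theorem Admissible.translation_injective (hI : Admissible I) :
    Function.Injective (translation I) := fun _ _ h =>
  hI.quotToLaurent_injective (Multiplicative.ofAdd.injective (SemidirectProduct.inl_injective h))

end AffineGroup

/-! ### Locally constant cocycles and their linearization at 0. -/

section Cocycles

variable {d e : ℕ} {I : Ideal (PolyRing d)} {J : Ideal (PolyRing e)}

variable (I J) in
/-- A map `φ` on unit spaces with a locally constant cocycle `κ` such that `(g, x) ↦ (κ g x, φ x)`
is a homomorphism of groupoids. Values of `κ` outside the domain of the partial action are
irrelevant. -/
structure OrbitCocycle where
  obj : Omega I → Omega J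
  coc : AffGroup I → Omega I → AffGroup J
  map : ∀ {g x y}, PartialAct I g x y → PartialAct J (coc g x) (obj x) (obj y)
  mul : ∀ {g h x y z}, PartialAct I g x y → PartialAct I h y z →
    coc (h * g) x = coc h y * coc g x
  locallyConstant : ∀ {g x y}, PartialAct I g x y →
    ∃ n, ∀ x' y', PartialAct I g x' y' → Cong I n x x' → coc g x' = coc g x

namespace OrbitCocycle

variable (Q : OrbitCocycle I J)

theorem coc_one (x : Omega I) : Q.coc 1 x = 1 := by
  have := Q.mul (partialAct_one I x) (partialAct_one I x)
  rw [mul_one] at this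
  exact left_eq_mul.1 this

/-- The cocycle on translations by elements of `A`. -/
def tr (a : PolyRing d ⧸ I) (x : Omega I) : AffGroup J := Q.coc (translation I a) x

theorem tr_zero (x : Omega I) : Q.tr 0 x = 1 := by
  rw [tr, translation_zero, coc_one]

theorem tr_add (a b : PolyRing d ⧸ I) (x : Omega I) :
    Q.tr (a + b) x = Q.tr a (toOmega I b + x) * Q.tr b x := by
  rw [tr, translation_add]
  exact Q.mul (partialAct_translation b x) (partialAct_translation a _)

/-- Compactness gives a modulus for each translation, and a finite generating set needs only one.
The cocycle identity extends it to all of A because translations preserve congruence. -/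
theorem exists_tr_uniform (hI : Admissible I) :
    ∃ n, ∀ a x y, Cong I n x y → Q.tr a y = Q.tr a x := by
  have h1 : ∀ a, ∃ n, ∀ x y, Cong I n x y → Q.tr a y = Q.tr a x := fun a =>
    hI.exists_uniform (Q.tr a) fun x => by
      obtain ⟨n, hn⟩ := Q.locallyConstant (partialAct_translation a x)
      exact ⟨n, fun y hy => hn y _ (partialAct_translation a y) hy⟩
  choose n hn using h1
  have := hI.finite
  obtain ⟨s, hs⟩ := exists_finset_closure_eq_top (A := PolyRing d ⧸ I)
  refine ⟨∑ a ∈ s, n a, fun a => ?_⟩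
  have ha : a ∈ AddSubgroup.closure (s : Set (PolyRing d ⧸ I)) := by rw [hs]; trivial
  induction ha using AddSubgroup.closure_induction with
  | mem a ha =>
    intro x y hxy
    exact hn a x y (hxy.mono (Finset.single_le_sum (f := n) (fun _ _ => zero_le) ha))
  | zero => intro x y _; rw [tr_zero, tr_zero]
  | add a b _ _ iha ihb =>
    intro x y hxy
    rw [tr_add, tr_add, ihb x y hxy, iha _ _ (hxy.add_left _)]
  | neg a _ ih =>
    intro x y hxy
    have key : ∀ z, Q.tr (-a) z = (Q.tr a (toOmega I (-a) + z))⁻¹ := by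
      intro z
      have := Q.tr_add a (-a) z
      rw [add_neg_cancel, tr_zero] at this
      exact eq_inv_of_mul_eq_one_right this.symm
    rw [key, key, ih _ _ (hxy.add_left _)]

/-- A modulus for the cocycle on translations. -/
def level (hI : Admissible I) : Fin d → ℕ := (Q.exists_tr_uniform hI).choose

theorem tr_eq_of_cong (hI : Admissible I) (a : PolyRing d ⧸ I) {x y : Omega I}
    (h : Cong I (Q.level hI) x y) : Q.tr a y = Q.tr a x :=
  (Q.exists_tr_uniform hI).choose_spec a x y h

theorem tr_add_toOmega (a b : PolyRing d ⧸ I) :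
    Q.tr (a + b) 0 = Q.tr a (toOmega I b) * Q.tr b 0 := by
  rw [tr_add, add_zero]

/-- Moving the base point from 0 by an element of u^l A, with l the level, does not change the
cocycle. This is what makes `germ` multiplicative. -/
theorem tr_add_mul (hI : Admissible I) (a b : PolyRing d ⧸ I) :
    Q.tr (a + mbar I (Q.level hI) * b) 0 = Q.tr a 0 * Q.tr (mbar I (Q.level hI) * b) 0 := by
  rw [tr_add_toOmega, Q.tr_eq_of_cong hI _ (cong_zero_toOmega_mul _ b)]

/-- The homomorphism `A → R_e / J R_e ⋊ ℤ^e` describing the cocycle on small translations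
near `0`. -/
def germ (hI : Admissible I) : Multiplicative (PolyRing d ⧸ I) →* AffGroup J where
  toFun a := Q.tr (mbar I (Q.level hI) * a.toAdd) 0
  map_one' := by rw [toAdd_one, mul_zero, tr_zero]
  map_mul' a b := by rw [toAdd_mul, mul_add, tr_add_mul]

theorem germ_apply (hI : Admissible I) (a : PolyRing d ⧸ I) :
    Q.germ hI (Multiplicative.ofAdd a) = Q.tr (mbar I (Q.level hI) * a) 0 := rfl

theorem partialAct_dilation_zero (n : Fin d → ℕ) : PartialAct I (dilation I n) 0 0 := by
  have := partialAct_dilation (I := I) n 0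
  rwa [map_zero] at this

/-- The cocycle at the isotropy element `u^n` of `0`. -/
def iso (n : Fin d → ℕ) : AffGroup J := Q.coc (dilation I n) 0

theorem iso_add (m n : Fin d → ℕ) : Q.iso (m + n) = Q.iso m * Q.iso n := by
  rw [iso, dilation_add]
  exact Q.mul (partialAct_dilation_zero n) (partialAct_dilation_zero m)

/-- Both sides are the cocycle at the same arrow out of 0, factored by u^n ∘ (translation by a) =
(translation by u^n a) ∘ u^n. -/
theorem dilation_tr (n : Fin d → ℕ) (a : PolyRing d ⧸ I) :
    Q.coc (dilation I n) (toOmega I a) * Q.tr a 0 = Q.tr (mbar I n * a) 0 * Q.iso n := by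
  have h1 : PartialAct I (translation I a) 0 (toOmega I a) := by
    have := partialAct_translation (I := I) a 0
    rwa [add_zero] at this
  have e1 := Q.mul h1 (partialAct_dilation n _)
  have h2 := partialAct_translation (I := I) (mbar I n * a) 0
  have e2 := Q.mul (partialAct_dilation_zero n) h2
  rw [← dilation_mul_translation] at e2
  exact e1.symm.trans e2

/-- Near 0 the cocycle at u^n equals its value at 0, so `dilation_tr` becomes a conjugation relation
on u^l A. -/
theorem exists_iso_comm (hI : Admissible I) (n : Fin d → ℕ) : ∃ l, ∀ a,
    Q.iso n * Q.germ hI (Multiplicative.ofAdd (mbar I l * a)) =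
      Q.germ hI (Multiplicative.ofAdd (mbar I n * (mbar I l * a))) * Q.iso n := by
  obtain ⟨l, hl⟩ := Q.locallyConstant (partialAct_dilation_zero (I := I) n)
  refine ⟨l, fun a => ?_⟩
  have := Q.dilation_tr n (mbar I (Q.level hI) * (mbar I l * a))
  rw [hl _ _ (partialAct_dilation n _)] at this
  · rw [germ_apply, germ_apply, ← mul_left_comm (mbar I n)]
    exact this
  · rw [mul_left_comm]
    exact cong_zero_toOmega_mul _ _

/-- The lattice part π is a homomorphism to a commutative group, so conjugation by `iso` disappears
and π(u^n x) = π(x) on u^l A. Thus π kills (u^n - 1) u^l A, which has finite index when u^n - 1 is a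
non-zero-divisor, and ℤ^e is torsion-free. -/
theorem germ_right (hI : Admissible I) (a : Multiplicative (PolyRing d ⧸ I)) :
    (Q.germ hI a).right = 1 := by
  have := hI.finite
  have := hI.torsionFree
  obtain ⟨n, hn⟩ := hI.exists_sub_one_mem
  obtain ⟨l, hl⟩ := Q.exists_iso_comm hI n
  let π : (PolyRing d ⧸ I) →+ (Fin e → ℤ) :=
    { toFun := fun a => (Q.germ hI (Multiplicative.ofAdd a)).right.toAdd
      map_zero' := by rw [ofAdd_zero, map_one]; rfl
      map_add' := fun a b => by rw [ofAdd_add, map_mul]; rfl }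
  have hπ : ∀ a, π a = (Q.germ hI (Multiplicative.ofAdd a)).right.toAdd := fun a => rfl
  have h1 : ∀ a, π (mbar I n * (mbar I l * a)) = π (mbar I l * a) := by
    intro a
    have := congrArg (fun g => g.right.toAdd) (hl a)
    simp only [SemidirectProduct.mul_right, toAdd_mul, ← hπ] at this
    rw [add_comm] at this
    exact (add_right_cancel this).symm
  obtain ⟨N, hN, hr⟩ := exists_smul_mem_range
    (AddMonoidHom.mulLeft ((mbar I n - 1) * mbar I l)) (fun x y hxy =>
      (mul_cancel_left_mem_nonZeroDivisors (mul_mem hn (hI.mbar_mem l))).1 hxy) rfl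
  obtain ⟨b, hb⟩ := hr a.toAdd
  have h2 : N • π a.toAdd = 0 := by
    rw [← map_nsmul, ← hb]
    change π ((mbar I n - 1) * mbar I l * b) = 0
    rw [mul_assoc, sub_mul, one_mul, map_sub, h1, sub_self]
  exact Multiplicative.toAdd.injective (smul_eq_zero_of_torsionFree hN h2)

/-- The homomorphism `A → R_e / J R_e` describing the cocycle on small translations near `0`. -/
def germLeft (hI : Admissible I) : (PolyRing d ⧸ I) →+ LaurentQuot J where
  toFun a := (Q.germ hI (Multiplicative.ofAdd a)).left.toAdd
  map_zero' := by
    rw [ofAdd_zero, map_one]; rfl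
  map_add' a b := by
    rw [ofAdd_add, map_mul, SemidirectProduct.mul_left, germ_right, map_one]
    rfl

theorem germ_eq (hI : Admissible I) (a : PolyRing d ⧸ I) :
    Q.germ hI (Multiplicative.ofAdd a) =
      SemidirectProduct.inl (Multiplicative.ofAdd (Q.germLeft hI a)) :=
  SemidirectProduct.ext rfl (Q.germ_right hI _)

/-- The isotropy at `0`, modulo translations. -/
def shift : (Fin d → ℕ) →+ (Fin e → ℤ) where
  toFun n := (Q.iso n).right.toAdd
  map_zero' := by
    have := Q.iso_add 0 0
    rw [add_zero, left_eq_mul] at this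
    rw [this]; rfl
  map_add' m n := by rw [iso_add]; rfl

/-- The conjugation relation gives this on u^l A; finite index and torsion-freeness of the Laurent
quotient give it everywhere. -/
theorem germLeft_mul (hI : Admissible I) (hJ : Admissible J) (n : Fin d → ℕ) (a : PolyRing d ⧸ I) :
    Q.germLeft hI (mbar I n * a) =
      zmono J (Multiplicative.ofAdd (Q.shift n)) * Q.germLeft hI a := by
  have := hI.finite
  have := hI.torsionFree
  obtain ⟨l, hl⟩ := Q.exists_iso_comm hI n
  have h1 : ∀ a, Q.germLeft hI (mbar I n * (mbar I l * a)) =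
      zmono J (Multiplicative.ofAdd (Q.shift n)) * Q.germLeft hI (mbar I l * a) := by
    intro a
    have := congrArg (fun g => g.left.toAdd) (hl a)
    rw [germ_eq, germ_eq] at this
    have h2 : (Q.iso n).left.toAdd +
        zmono J (Q.iso n).right * Q.germLeft hI (mbar I l * a) =
        Q.germLeft hI (mbar I n * (mbar I l * a)) +
          zmono J 1 * (Q.iso n).left.toAdd := this
    rw [map_one, one_mul, add_comm] at h2
    exact (add_right_cancel h2).symm
  obtain ⟨N, hN, hr⟩ := exists_smul_mem_range (AddMonoidHom.mulLeft (mbar I l))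
    (fun x y hxy => hI.mbar_cancel hxy) rfl
  obtain ⟨b, hb⟩ := hr a
  have hb' : mbar I l * b = N • a := hb
  refine sub_eq_zero.1 (hJ.laurentQuot_torsionFree hN ?_)
  rw [smul_sub, ← map_nsmul, ← mul_smul_comm, ← hb', ← mul_smul_comm N, ← map_nsmul, ← hb', h1,
    sub_self]

theorem exists_denominator (hI : Admissible I) (χ : (PolyRing d ⧸ I) →+ LaurentQuot J) :
    ∃ m, ∀ a, ∃ b, quotToLaurent J b = quotToLaurent J (mbar J m) * χ a := by
  choose m f hm using fun a => exists_mbar_mul_eq (χ a)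
  have := hI.finite
  obtain ⟨s, hs⟩ := exists_finset_closure_eq_top (A := PolyRing d ⧸ I)
  refine ⟨∑ a ∈ s, m a, fun a => ?_⟩
  have ha : a ∈ AddSubgroup.closure (s : Set (PolyRing d ⧸ I)) := by rw [hs]; trivial
  induction ha using AddSubgroup.closure_induction with
  | mem a ha =>
    obtain ⟨k, hk⟩ := exists_add_of_le
      (Finset.single_le_sum (f := m) (fun _ _ => zero_le) ha)
    refine ⟨mbar J k * f a, ?_⟩
    rw [hk, mbar_add, map_mul, map_mul, hm]
    ring
  | zero => exact ⟨0, by simp⟩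
  | add a b _ _ iha ihb =>
    obtain ⟨x, hx⟩ := iha
    obtain ⟨y, hy⟩ := ihb
    exact ⟨x + y, by rw [map_add, map_add, mul_add, hx, hy]⟩
  | neg a _ ih =>
    obtain ⟨x, hx⟩ := ih
    exact ⟨-x, by rw [map_neg, map_neg, hx]; ring⟩

/-- `R` undoes `Q` on arrows. -/
def IsLeftInverse (R : OrbitCocycle J I) (Q : OrbitCocycle I J) : Prop :=
  ∀ ⦃g x y⦄, PartialAct I g x y → R.coc (Q.coc g x) (Q.obj x) = g

variable {Q} {R : OrbitCocycle J I}

/-- If the germ at a is trivial, the cocycle takes the translation by u^l a at 0 to 1. The left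
inverse sends 1 back to 1, so that translation is itself trivial. -/
theorem IsLeftInverse.germLeft_injective (h : IsLeftInverse R Q) (hI : Admissible I) :
    Function.Injective (Q.germLeft hI) := by
  rw [injective_iff_map_eq_zero]
  intro a ha
  have h1 := Q.germ_eq hI a
  rw [ha, ofAdd_zero, map_one, germ_apply, tr] at h1
  have h2 := h (partialAct_translation (mbar I (Q.level hI) * a) 0)
  rw [h1, coc_one, ← translation_zero] at h2
  have h3 := hI.translation_injective h2
  exact hI.mbar_cancel (n := Q.level hI) (by rw [← h3, mul_zero])

/-- An orbit cocycle with a left inverse induces an injective homomorphism `A → A'`, equivariant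
over `Q.shift`. -/
theorem IsLeftInverse.exists_equivariant (h : IsLeftInverse R Q) (hI : Admissible I)
    (hJ : Admissible J) : ∃ χ : (PolyRing d ⧸ I) →+ (PolyRing e ⧸ J), Function.Injective χ ∧
      ∀ (n : Fin d → ℕ) (p q : Fin e → ℕ), (∀ i, (q i : ℤ) = p i + Q.shift n i) →
        ∀ a, mbar J p * χ (mbar I n * a) = mbar J q * χ a := by
  obtain ⟨m, hm⟩ := exists_denominator hI (Q.germLeft hI)
  choose f hf using hm
  have hinj := hJ.quotToLaurent_injective
  -- A common monomial denominator u^m moves the image of `germLeft` into the polynomial quotient.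
  let χ : (PolyRing d ⧸ I) →+ (PolyRing e ⧸ J) := AddMonoidHom.mk' f fun a b => hinj (by
    rw [map_add, hf, hf, hf, map_add, mul_add])
  have hχ : ∀ a, quotToLaurent J (χ a) = quotToLaurent J (mbar J m) * Q.germLeft hI a := hf
  refine ⟨χ, fun a b hab => h.germLeft_injective hI ?_, fun n p q hpq a => hinj ?_⟩
  · have := congrArg (quotToLaurent J) hab
    rw [hχ, hχ, ← zmono_natCast] at this
    exact (isUnit_zmono _).mul_left_cancel this
  · rw [map_mul (quotToLaurent J), map_mul (quotToLaurent J), hχ, hχ, germLeft_mul Q hI hJ]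
    have := zmono_shift J p q (Multiplicative.ofAdd (Q.shift n)) hpq
    rw [show quotToLaurent J (mbar J q) = _ from this.symm]
    change quotToLaurent J (mbar J p) * _ = quotToLaurent J (mbar J p) * _ * _
    ring

variable (Q)

/-- The extension of `Q.shift` to `ℤ^d`. -/
abbrev shiftInt : (Fin d → ℤ) →+ (Fin e → ℤ) := extendInt Q.shift

theorem shiftInt_natCast (n : Fin d → ℕ) : Q.shiftInt (fun i => (n i : ℤ)) = Q.shift n :=
  extendInt_natCast _ n

/-- The lattice part depends only on a modulo u^l A, since `germ` has none; that quotient is finite.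
-/
theorem exists_bound_tr_zero (hI : Admissible I) :
    ∃ M : ℤ, ∀ a i, |(Q.tr a 0).right.toAdd i| ≤ M := by
  have := hI.finite_quotient (mulSubgroup I (Q.level hI))
  obtain ⟨M, hM⟩ := Finite.exists_le
    (fun c : ((PolyRing d ⧸ I) ⧸ (mulSubgroup I (Q.level hI)).1) × Fin e =>
      |(Q.tr c.1.out 0).right.toAdd c.2|)
  refine ⟨M, fun a i => ?_⟩
  have h1 : (QuotientAddGroup.mk (Quotient.out (QuotientAddGroup.mk a :
      (PolyRing d ⧸ I) ⧸ (mulSubgroup I (Q.level hI)).1)) : _ ⧸ (mulSubgroup I (Q.level hI)).1) =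
      QuotientAddGroup.mk a := QuotientAddGroup.out_eq' _
  obtain ⟨b, hb⟩ := (mem_mulSubgroup I).1 (QuotientAddGroup.eq.1 h1)
  have h2 := Q.tr_add_mul hI (Quotient.out (QuotientAddGroup.mk a :
      (PolyRing d ⧸ I) ⧸ (mulSubgroup I (Q.level hI)).1)) b
  rw [← germ_apply, hb, add_neg_cancel_left] at h2
  rw [h2, SemidirectProduct.mul_right, germ_right, mul_one]
  exact hM (QuotientAddGroup.mk a, i)

/-- Up to a bounded error, the `ℤ^e`-part of the cocycle is `Q.shiftInt`. -/
theorem exists_bound (hI : Admissible I) : ∃ M : ℤ, ∀ g x y, PartialAct I g x y → ∀ i,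
    |(Q.coc g x).right.toAdd i - Q.shiftInt g.right.toAdd i| ≤ M := by
  obtain ⟨M, hM⟩ := Q.exists_bound_tr_zero hI
  -- Approximating x by b in A, the value at x is a quotient of two values at 0, each bounded by M.
  -- The same approximation gives `hdil`.
  have htr : ∀ a x i, |(Q.tr a x).right.toAdd i| ≤ 2 * M := by
    intro a x i
    obtain ⟨b, hb⟩ := exists_cong_toOmega (Q.level hI) x
    rw [Q.tr_eq_of_cong hI a hb.symm]
    have h1 := congrArg (fun g => g.right.toAdd i) (Q.tr_add_toOmega a b)
    simp only [SemidirectProduct.mul_right, toAdd_mul, Pi.add_apply] at h1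
    have h2 := abs_le.1 (hM (a + b) i)
    have h3 := abs_le.1 (hM b i)
    rw [abs_le]
    constructor <;> linarith
  have hdil : ∀ n x i, |(Q.coc (dilation I n) x).right.toAdd i - Q.shift n i| ≤ 2 * M := by
    intro n x i
    obtain ⟨l, hl⟩ := Q.locallyConstant (partialAct_dilation n x)
    obtain ⟨b, hb⟩ := exists_cong_toOmega l x
    rw [← hl _ _ (partialAct_dilation n _) hb]
    have h1 := congrArg (fun g => g.right.toAdd i) (Q.dilation_tr n b)
    simp only [SemidirectProduct.mul_right, toAdd_mul, Pi.add_apply] at h1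
    have h4 : (Q.iso n).right.toAdd i = Q.shift n i := rfl
    have h2 := abs_le.1 (hM (mbar I n * b) i)
    have h3 := abs_le.1 (hM b i)
    rw [abs_le]
    constructor <;> linarith
  -- Three errors of at most 2M enter, from the three factors in u^m g = (translation by a) u^k.
  refine ⟨6 * M, fun g x y h i => ?_⟩
  obtain ⟨m, k, a, h1, h2, h3⟩ := h.exists_factorization
  have e1 := Q.mul h (partialAct_dilation m y)
  have e2 := Q.mul (partialAct_dilation k x) (partialAct_translation a _)
  rw [h2] at e1
  have e3 := congrArg (fun g => g.right.toAdd i) (e1.symm.trans e2)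
  simp only [SemidirectProduct.mul_right, toAdd_mul, Pi.add_apply] at e3
  have e4 : Q.shiftInt g.right.toAdd i = Q.shift k i - Q.shift m i := by
    have hg : g.right.toAdd = (fun i => (k i : ℤ)) - fun i => (m i : ℤ) := by
      funext j
      rw [Pi.sub_apply, h1 j, add_sub_cancel_left]
    rw [hg, map_sub, shiftInt_natCast, shiftInt_natCast, Pi.sub_apply]
  have f1 := abs_le.1 (htr a (mulOmega I k x) i)
  have f2 := abs_le.1 (hdil k x i)
  have f3 := abs_le.1 (hdil m y i)
  rw [tr] at f1
  rw [e4, abs_le]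
  constructor <;> linarith

/-- The bound for `R`, applied to the image of the arrow u^n at 0, bounds the discrepancy uniformly
in n; being additive in n, it vanishes. The image of 0 need not be 0, so the bound has to hold at
all base points. -/
theorem shiftInt_shift_of_isLeftInverse {R : OrbitCocycle J I} {Q : OrbitCocycle I J}
    (h : IsLeftInverse R Q) (hJ : Admissible J) (n : Fin d → ℕ) (i : Fin d) :
    R.shiftInt (Q.shift n) i = n i := by
  obtain ⟨M, hM⟩ := R.exists_bound hJ
  have h1 : ∀ n i, |(n i : ℤ) - R.shiftInt (Q.shift n) i| ≤ M := by
    intro n i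
    have h2 := hM _ _ _ (Q.map (partialAct_dilation_zero n)) i
    rw [h (partialAct_dilation_zero n)] at h2
    exact h2
  by_contra hne
  -- A non-zero integer discrepancy multiplied by M + 1 would exceed the bound; `toNat` covers a
  -- negative M.
  have h3 := h1 ((M.toNat + 1) • n) i
  rw [map_nsmul, map_nsmul] at h3
  simp only [Pi.smul_apply, nsmul_eq_mul, smul_eq_mul] at h3
  push_cast at h3
  rw [← mul_sub, abs_mul] at h3
  have h4 : 1 ≤ |(n i : ℤ) - R.shiftInt (Q.shift n) i| :=
    Int.one_le_abs (sub_ne_zero.2 fun h => hne h.symm)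
  have h5 : M ≤ M.toNat := Int.self_le_toNat M
  have h6 : (0 : ℤ) ≤ M.toNat := Int.natCast_nonneg _
  rw [abs_of_nonneg (by linarith)] at h3
  nlinarith

end OrbitCocycle
end Cocycles

/-! ### Substitutions of monomials and isomorphisms of the actions. -/

section PolyMap

variable {d e : ℕ} (t : (Fin d → ℕ) →+ (Fin e → ℕ))

/-- The ring homomorphism `ℤ[u₁,…,u_d] → ℤ[u₁,…,u_e]` with `u^n ↦ u^{t n}`. -/
def polyMap : PolyRing d →+* PolyRing e :=
  (MvPolynomial.aeval fun k => mono (t (Pi.single k 1))).toRingHom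

theorem polyMap_X (k : Fin d) : polyMap t (MvPolynomial.X k) = mono (t (Pi.single k 1)) := by
  simp [polyMap]

theorem polyMap_mono (n : Fin d → ℕ) : polyMap t (mono n) = mono (t n) := by
  let M : Multiplicative (Fin e → ℕ) →* PolyRing e :=
    ⟨⟨fun n => mono n.toAdd, mono_zero⟩, fun m n => mono_add _ _⟩
  have h1 : ∀ n, M (Multiplicative.ofAdd n) = mono n := fun _ => rfl
  conv_rhs => rw [eq_sum_smul_single n, map_sum, ← h1, ofAdd_sum, map_prod]
  rw [mono, map_prod]
  refine Finset.prod_congr rfl fun k _ => ?_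
  rw [map_pow, polyMap_X, map_nsmul, ofAdd_nsmul, map_pow, h1]

theorem polyMap_polyMap (s : (Fin e → ℕ) →+ (Fin d → ℕ)) (h : ∀ n, s (t n) = n)
    (f : PolyRing d) : polyMap s (polyMap t f) = f := by
  have : (polyMap s).comp (polyMap t) = RingHom.id _ := by
    refine MvPolynomial.ringHom_ext (fun c => by simp) fun k => ?_
    rw [RingHom.comp_apply, polyMap_X, polyMap_mono, h]
    simp [mono, Pi.single_apply, pow_ite]
  exact DFunLike.congr_fun this f

variable {t} {I : Ideal (PolyRing d)} {J : Ideal (PolyRing e)}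

theorem map_mk_mul_of_equivariant (χ : (PolyRing d ⧸ I) →+ (PolyRing e ⧸ J))
    (h : ∀ n a, χ (mbar I n * a) = mbar J (t n) * χ a) (f : PolyRing d) (a : PolyRing d ⧸ I) :
    χ (Ideal.Quotient.mk I f * a) = Ideal.Quotient.mk J (polyMap t f) * χ a := by
  induction f using MvPolynomial.induction_on generalizing a with
  | C c =>
    have h1 : (MvPolynomial.C c : PolyRing d) = (c : PolyRing d) := by simp
    rw [h1, map_intCast, map_intCast, map_intCast, ← zsmul_eq_mul, ← zsmul_eq_mul, map_zsmul]
  | add f g hf hg => rw [map_add, map_add, map_add, add_mul, add_mul, map_add, hf, hg]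
  | mul_X f k hf =>
    have hk := h (Pi.single k 1) a
    rw [mbar_single] at hk
    rw [map_mul (Ideal.Quotient.mk I), map_mul (polyMap t), map_mul (Ideal.Quotient.mk J),
      mul_assoc, mul_assoc, hf, polyMap_X]
    congr 1

/-- Although χ need not be multiplicative, it intertwines multiplication by f and by its substitute.
Taking a with χ(a) = N·1, the relation f a = 0 forces N times the substitute to vanish in a
torsion-free ring. -/
theorem polyMap_mem_of_equivariant (hJ : IsAddTorsionFree (PolyRing e ⧸ J))
    (χ : (PolyRing d ⧸ I) →+ (PolyRing e ⧸ J))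
    (h : ∀ n a, χ (mbar I n * a) = mbar J (t n) * χ a)
    {N : ℕ} (hN : N ≠ 0) (hsurj : ∀ b, ∃ a, χ a = N • b) {f : PolyRing d} (hf : f ∈ I) :
    polyMap t f ∈ J := by
  obtain ⟨a, ha⟩ := hsurj 1
  have h1 := map_mk_mul_of_equivariant χ h f a
  rw [Ideal.Quotient.eq_zero_iff_mem.2 hf, zero_mul, map_zero, ha, mul_smul_comm, mul_one] at h1
  exact Ideal.Quotient.eq_zero_iff_mem.1 (smul_eq_zero_of_torsionFree hN h1.symm)

variable (I J) in
/-- Isomorphisms of the actions of `ℕ^d` and `ℕ^e` that respect the ring structures. -/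
structure RingActionEquiv where
  exponents : (Fin d → ℕ) ≃+ (Fin e → ℕ)
  ring : (PolyRing d ⧸ I) ≃+* (PolyRing e ⧸ J)
  map_mbar : ∀ n, ring (mbar I n) = mbar J (exponents n)

/-- Exponent isomorphisms matching the ideals induce isomorphisms of the actions. -/
def RingActionEquiv.mk' (t : (Fin d → ℕ) ≃+ (Fin e → ℕ))
    (h : ∀ f ∈ I, polyMap t.toAddMonoidHom f ∈ J)
    (h' : ∀ f ∈ J, polyMap t.symm.toAddMonoidHom f ∈ I) : RingActionEquiv I J where
  exponents := t
  ring := RingEquiv.ofRingHom (Ideal.quotientMap J (polyMap t.toAddMonoidHom) h)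
    (Ideal.quotientMap I (polyMap t.symm.toAddMonoidHom) h')
    (Ideal.Quotient.ringHom_ext (RingHom.ext fun f =>
      congrArg (Ideal.Quotient.mk J) (polyMap_polyMap _ _ (by simp) f)))
    (Ideal.Quotient.ringHom_ext (RingHom.ext fun f =>
      congrArg (Ideal.Quotient.mk I) (polyMap_polyMap _ _ (by simp) f)))
  map_mbar n := congrArg (Ideal.Quotient.mk J) (polyMap_mono _ n)

theorem RingActionEquiv.actionsIsomorphic (E : RingActionEquiv I J) :
    ActionsIsomorphic (act I) (act J) := by
  refine ⟨AddEquiv.toMultiplicative E.exponents, E.ring.toAddEquiv, fun s x => ?_⟩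
  change E.ring (mbar I s.toAdd * x) = mbar J (E.exponents s.toAdd) * E.ring x
  rw [map_mul, E.map_mbar]

/-- The given group isomorphism need not respect products; only its exponent map is kept, which
matches the two ideals and so induces a new, multiplicative isomorphism. -/
theorem nonempty_ringActionEquiv_of_actionsIsomorphic (hI : IsAddTorsionFree (PolyRing d ⧸ I))
    (hJ : IsAddTorsionFree (PolyRing e ⧸ J)) (h : ActionsIsomorphic (act I) (act J)) :
    Nonempty (RingActionEquiv I J) := by
  obtain ⟨t, b, hb⟩ := h
  let t' : (Fin d → ℕ) ≃+ (Fin e → ℕ) := AddEquiv.toMultiplicative.symm t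
  have hb' : ∀ n a, b (mbar I n * a) = mbar J (t' n) * b a := fun n a =>
    hb (Multiplicative.ofAdd n) a
  clear_value t'
  have hb'' : ∀ n a, b.symm (mbar J n * a) = mbar I (t'.symm n) * b.symm a := by
    intro n a
    apply b.injective
    rw [hb', AddEquiv.apply_symm_apply, AddEquiv.apply_symm_apply, AddEquiv.apply_symm_apply]
  have h1 : ∀ f ∈ I, polyMap t'.toAddMonoidHom f ∈ J := fun f hf =>
    polyMap_mem_of_equivariant (t := t'.toAddMonoidHom) hJ b.toAddMonoidHom hb' one_ne_zero
      (fun y => ⟨b.symm y, by rw [one_smul]; exact b.apply_symm_apply y⟩) hf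
  have h2 : ∀ f ∈ J, polyMap t'.symm.toAddMonoidHom f ∈ I := fun f hf =>
    polyMap_mem_of_equivariant (t := t'.symm.toAddMonoidHom) hI b.symm.toAddMonoidHom hb''
      one_ne_zero (fun y => ⟨b y, by rw [one_smul]; exact b.symm_apply_apply y⟩) hf
  exact ⟨.mk' t' h1 h2⟩

end PolyMap

/-! ### Determinants along an intertwining injection. -/

section Determinants

variable {A A' : Type} [CommRing A] [CommRing A'] [Module.Finite ℤ A] [IsAddTorsionFree A]
  [Module.Finite ℤ A'] [IsAddTorsionFree A']

/-- After identifying the two free modules of equal rank, χ becomes an endomorphism with non-zero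
determinant, which cancels from the determinant of the intertwining relation. -/
theorem mulDet_mul_eq_of_intertwine (χ : A →+ A') (hχ : Function.Injective χ)
    (h : Module.finrank ℤ A = Module.finrank ℤ A') {a : A} {p q : A'}
    (hpq : ∀ x, p * χ (a * x) = q * χ x) : mulDet p * mulDet a = mulDet q := by
  let L := LinearEquiv.ofFinrankEq A' A h.symm
  let X : A →ₗ[ℤ] A := L.toLinearMap ∘ₗ χ.toIntLinearMap
  have hX : LinearMap.det X ≠ 0 := by
    intro h0
    obtain ⟨x, hx, hx0⟩ := SetLike.exists_of_lt (LinearMap.bot_lt_ker_of_det_eq_zero h0)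
    apply hx0
    have hx' : L (χ x) = 0 := hx
    exact hχ (L.injective (by rw [hx', map_zero, map_zero]))
  have hc : ∀ b : A', mulDet b =
      LinearMap.det (L.toLinearMap ∘ₗ LinearMap.mulLeft ℤ b ∘ₗ L.symm.toLinearMap) := fun b =>
    (LinearMap.det_conj _ L).symm
  have key : (L.toLinearMap ∘ₗ LinearMap.mulLeft ℤ p ∘ₗ L.symm.toLinearMap) ∘ₗ X ∘ₗ
      LinearMap.mulLeft ℤ a =
      (L.toLinearMap ∘ₗ LinearMap.mulLeft ℤ q ∘ₗ L.symm.toLinearMap) ∘ₗ X := by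
    ext x
    simpa [X] using hpq x
  have hdet := congrArg LinearMap.det key
  rw [LinearMap.det_comp, LinearMap.det_comp, LinearMap.det_comp, ← hc, ← hc] at hdet
  have hdet' : mulDet p * (LinearMap.det X * mulDet a) = mulDet q * LinearMap.det X := hdet
  refine mul_right_cancel₀ hX ?_
  rw [← hdet']
  ring

end Determinants

/-! ### From a pair of inverse cocycles to a ring isomorphism. -/

section Rigidity

variable {d e : ℕ} {I : Ideal (PolyRing d)} {J : Ideal (PolyRing e)}

theorem finrank_le_of_injective (hJ : Admissible J) (χ : (PolyRing d ⧸ I) →+ (PolyRing e ⧸ J))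
    (hχ : Function.Injective χ) :
    Module.finrank ℤ (PolyRing d ⧸ I) ≤ Module.finrank ℤ (PolyRing e ⧸ J) := by
  have := hJ.finite
  exact LinearMap.finrank_le_finrank_of_injective (f := χ.toIntLinearMap) hχ

namespace OrbitCocycle

variable {Q : OrbitCocycle I J} {R : OrbitCocycle J I}

theorem finrank_eq (h : IsLeftInverse R Q) (h' : IsLeftInverse Q R) (hI : Admissible I)
    (hJ : Admissible J) :
    Module.finrank ℤ (PolyRing d ⧸ I) = Module.finrank ℤ (PolyRing e ⧸ J) := by
  obtain ⟨χ, hχ, -⟩ := h.exists_equivariant hI hJ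
  obtain ⟨χ', hχ', -⟩ := h'.exists_equivariant hJ hI
  exact le_antisymm (finrank_le_of_injective hJ χ hχ) (finrank_le_of_injective hI χ' hχ')

/-- If coordinate i were negative, u_i would occur in u^p but not in u^q, while det(u^p) det(u^n) =
det(u^q). A prime dividing the norm of u_i and of no other variable contradicts this. -/
theorem shift_nonneg (h : IsLeftInverse R Q) (h' : IsLeftInverse Q R) (hI : Admissible I)
    (hJ : Admissible J) (n : Fin d → ℕ) (i : Fin e) : 0 ≤ Q.shift n i := by
  have := hI.finite
  have := hI.torsionFree
  have := hJ.finite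
  have := hJ.torsionFree
  obtain ⟨χ, hχ, heq⟩ := h.exists_equivariant hI hJ
  -- The negative and positive parts of the shift, so that q = p + shift with disjoint supports.
  let p : Fin e → ℕ := fun i => (-(Q.shift n i)).toNat
  let q : Fin e → ℕ := fun i => (Q.shift n i).toNat
  have hdet := mulDet_mul_eq_of_intertwine χ hχ (finrank_eq h h' hI hJ)
    (heq n p q fun i => by simp only [p, q]; omega)
  by_contra hneg
  obtain ⟨P, hP, hdvd, hndvd⟩ := hJ.exists_prime i
  have hP' : Prime (P : ℤ) := Nat.prime_iff_prime_int.1 hP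
  have h1 : (P : ℤ) ∣ mulDet (mbar J q) := by
    rw [← hdet, mulDet_mbar]
    refine Dvd.dvd.mul_right ?_ _
    refine (dvd_pow hdvd ?_).trans (Finset.dvd_prod_of_mem _ (Finset.mem_univ i))
    simp only [p]; omega
  rw [mulDet_mbar, hP'.dvd_finsetProd_iff] at h1
  obtain ⟨k, -, hk⟩ := h1
  by_cases hki : k = i
  · subst hki
    have : q k = 0 := by simp only [q]; omega
    rw [this, pow_zero] at hk
    exact hP'.not_isUnit (isUnit_of_dvd_one hk)
  · exact hndvd k hki (hP'.dvd_of_dvd_pow hk)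

theorem nonempty_ringActionEquiv (h : IsLeftInverse R Q) (h' : IsLeftInverse Q R)
    (hI : Admissible I) (hJ : Admissible J) : Nonempty (RingActionEquiv I J) := by
  have := hI.finite
  have := hI.torsionFree
  have := hJ.finite
  have := hJ.torsionFree
  have hs : ∀ n i, ((Q.shift n i).toNat : ℤ) = Q.shift n i := fun n i =>
    Int.toNat_of_nonneg (shift_nonneg h h' hI hJ n i)
  have hs' : ∀ n i, ((R.shift n i).toNat : ℤ) = R.shift n i := fun n i =>
    Int.toNat_of_nonneg (shift_nonneg h' h hJ hI n i)
  let t : (Fin d → ℕ) ≃+ (Fin e → ℕ) :=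
    { toFun := fun n i => (Q.shift n i).toNat
      invFun := fun n i => (R.shift n i).toNat
      left_inv := fun n => by
        funext i
        zify
        rw [hs', ← shiftInt_natCast]
        simp only [hs]
        exact shiftInt_shift_of_isLeftInverse h hJ n i
      right_inv := fun n => by
        funext i
        zify
        rw [hs, ← shiftInt_natCast]
        simp only [hs']
        exact shiftInt_shift_of_isLeftInverse h' hI n i
      map_add' := fun m n => by
        funext i
        zify
        rw [hs, Pi.add_apply]
        push_cast
        rw [hs, hs, map_add, Pi.add_apply] }
  obtain ⟨χ, hχ, heq⟩ := h.exists_equivariant hI hJ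
  obtain ⟨χ', hχ', heq'⟩ := h'.exists_equivariant hJ hI
  obtain ⟨N, hN, hr⟩ := exists_smul_mem_range χ hχ (finrank_eq h h' hI hJ)
  obtain ⟨N', hN', hr'⟩ := exists_smul_mem_range χ' hχ' (finrank_eq h h' hI hJ).symm
  refine ⟨.mk' t (fun f hf => polyMap_mem_of_equivariant hJ.torsionFree χ (fun n a => ?_) hN hr hf)
    (fun f hf => polyMap_mem_of_equivariant hI.torsionFree χ' (fun n a => ?_) hN' hr' hf)⟩
  · have := heq n 0 (t n) (fun i => by
      rw [Pi.zero_apply, Nat.cast_zero, zero_add]; exact hs n i) a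
    rwa [mbar_zero, one_mul] at this
  · have := heq' n 0 (t.symm n) (fun i => by
      rw [Pi.zero_apply, Nat.cast_zero, zero_add]; exact hs' n i) a
    rwa [mbar_zero, one_mul] at this

end OrbitCocycle
end Rigidity

/-! ### Cocycles from isomorphisms of topological groupoids. -/

section ArrowMaps

variable {d e : ℕ} {I : Ideal (PolyRing d)} {J : Ideal (PolyRing e)}

/-- The arrow `(g, x)` with target `y`. -/
def arrow {g : AffGroup I} {x y : Omega I} (h : PartialAct I g x y) : Arrows (Omega I) :=
  ⟨x, y, ⟨g, h⟩⟩

/-- The group element of an arrow. -/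
def Arrows.group (a : Arrows (Omega I)) : AffGroup I := a.2.2.1

theorem Arrows.partialAct {a : Arrows (Omega I)} {x y : Omega I} (hx : a.1 = x)
    (hy : a.2.1 = y) : PartialAct I (Arrows.group a) x y := by
  subst hx hy
  exact a.2.2.2

theorem Admissible.arrows_ext (hI : Admissible I) {a b : Arrows (Omega I)} (h : a.1 = b.1)
    (h' : Arrows.group a = Arrows.group b) : a = b := by
  obtain ⟨x, y, g, hg⟩ := a
  obtain ⟨x', y', g', hg'⟩ := b
  change x = x' at h
  change g = g' at h'
  subst h h'
  obtain rfl := hI.partialAct_unique hg hg'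
  rfl

/-- A map of arrow sets coming from a groupoid homomorphism with unit map `φ`. -/
structure IsArrowHom (φ : Omega I → Omega J) (E : Arrows (Omega I) → Arrows (Omega J)) :
    Prop where
  source : ∀ a, (E a).1 = φ a.1
  target : ∀ a, (E a).2.1 = φ a.2.1
  comp : ∀ {g h x y z} (hg : PartialAct I g x y) (hh : PartialAct I h y z),
    Arrows.group (E (arrow (partialAct_mul I hg hh))) =
      Arrows.group (E (arrow hh)) * Arrows.group (E (arrow hg))

theorem isArrowHom_mapArrows (F : Omega I ⥤ Omega J) : IsArrowHom F.obj (mapArrows F) where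
  source _ := rfl
  target _ := rfl
  comp {g h x y z} hg hh := by
    let f₁ : x ⟶ y := ⟨g, hg⟩
    let f₂ : y ⟶ z := ⟨h, hh⟩
    exact congrArg Subtype.val (F.map_comp f₁ f₂)

theorem IsArrowHom.coe_one {φ : Omega I → Omega J} {E : Arrows (Omega I) → Arrows (Omega J)}
    (hE : IsArrowHom φ E) (hJ : Admissible J) (x : Omega I) :
    E (arrow (partialAct_one I x)) = arrow (partialAct_one J (φ x)) := by
  refine hJ.arrows_ext (hE.source _) ?_
  have h1 := hE.comp (partialAct_one I x) (partialAct_one I x)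
  have h2 : arrow (partialAct_mul I (partialAct_one I x) (partialAct_one I x)) =
      arrow (partialAct_one I x) := by
    simp only [arrow, mul_one]
  rw [h2] at h1
  exact left_eq_mul.1 h1

/-- Only the arrow map is known to be bijective. The inverse on units is recovered from identity
arrows, which E preserves. -/
theorem IsArrowHom.of_inverse {φ : Omega I → Omega J}
    {E : Arrows (Omega I) → Arrows (Omega J)} (hE : IsArrowHom φ E) (hJ : Admissible J)
    {E' : Arrows (Omega J) → Arrows (Omega I)}
    (h : Function.LeftInverse E' E) (h' : Function.RightInverse E' E) :
    IsArrowHom (fun y => (E' (arrow (partialAct_one J y))).1) E' := by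
  have hφ : ∀ x, (E' (arrow (partialAct_one J (φ x)))).1 = x := by
    intro x
    rw [← hE.coe_one hJ, h]; rfl
  have hinj : Function.Injective φ := fun x y hxy => by rw [← hφ x, ← hφ y, hxy]
  refine ⟨fun b => ?_, fun b => ?_, fun {g k x y z} hg hk => ?_⟩
  · obtain ⟨a, rfl⟩ := h'.surjective b
    rw [hE.source, hφ, h]
  · obtain ⟨a, rfl⟩ := h'.surjective b
    rw [hE.target, hφ, h]
  · obtain ⟨⟨x₁, y₁, g₁, p₁⟩, h₁⟩ := h'.surjective (arrow hg)
    obtain ⟨⟨x₂, y₂, g₂, p₂⟩, h₂⟩ := h'.surjective (arrow hk)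
    have e1 : y = φ y₁ := by rw [← hE.target ⟨x₁, y₁, g₁, p₁⟩, h₁]; rfl
    have e2 : y = φ x₂ := by rw [← hE.source ⟨x₂, y₂, g₂, p₂⟩, h₂]; rfl
    -- Injectivity on units makes the preimages of a composable pair composable.
    obtain rfl : y₁ = x₂ := hinj (e1.symm.trans e2)
    have h₁' : E (arrow p₁) = arrow hg := h₁
    have h₂' : E (arrow p₂) = arrow hk := h₂
    have key : E (arrow (partialAct_mul I p₁ p₂)) = arrow (partialAct_mul J hg hk) := by
      refine hJ.arrows_ext ?_ ?_
      · rw [hE.source]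
        change φ (arrow p₁).1 = _
        rw [← hE.source, h₁']; rfl
      · rw [hE.comp p₁ p₂, h₁', h₂']; rfl
    rw [← key, ← h₁', ← h₂', h, h, h]
    rfl

open Classical in
/-- The cocycle of a continuous homomorphism of groupoids. -/
def IsArrowHom.orbitCocycle {φ : Omega I → Omega J}
    {E : Arrows (Omega I) → Arrows (Omega J)} (hE : IsArrowHom φ E) (hI : Admissible I)
    (hcont : Continuous E) : OrbitCocycle I J :=
  have key : ∀ {g x y} (h : PartialAct I g x y),
      (if h : ∃ y, PartialAct I g x y then Arrows.group (E (arrow h.choose_spec)) else 1) =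
        Arrows.group (E (arrow h)) := by
    intro g x y h
    have hex : ∃ y, PartialAct I g x y := ⟨y, h⟩
    rw [dif_pos hex]
    congr 2
    exact hI.arrows_ext rfl rfl
  { obj := φ
    coc := fun g x =>
      if h : ∃ y, PartialAct I g x y then Arrows.group (E (arrow h.choose_spec)) else 1
    map := fun {g x y} h => by
      rw [key h]
      exact Arrows.partialAct (hE.source _) (hE.target _)
    mul := fun hg hh => by rw [key hg, key hh, key (partialAct_mul I hg hh), hE.comp]
    locallyConstant := fun {g x y} h => by
      let := completionTopology (act I)
      let := completionTopology (act J)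
      let : TopologicalSpace (AffGroup I) := ⊥
      let : TopologicalSpace (AffGroup J) := ⊥
      have : DiscreteTopology (AffGroup J) := ⟨rfl⟩
      have hind : Continuous fun a : Arrows (Omega J) =>
          ((a.2.2.1, a.1) : AffGroup J × Omega J) := continuous_induced_dom
      have hgroup : Continuous (fun a : Arrows (Omega J) => Arrows.group a) :=
        continuous_fst.comp hind
      -- The group component is discrete, so having the same image group element is an open
      -- condition on arrows; its slice at g contains a congruence neighbourhood of x within the
      -- domain.
      have hopen : IsOpen {a : Arrows (Omega I) | Arrows.group (E a) = Arrows.group (E (arrow h))} :=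
        (isOpen_discrete {k | k = Arrows.group (E (arrow h))}).preimage (hgroup.comp hcont)
      obtain ⟨U, hU, hUeq⟩ := isOpen_induced_iff.1 hopen
      have hmem : ∀ {x y} (h' : PartialAct I g x y), (g, x) ∈ U ↔
          Arrows.group (E (arrow h')) = Arrows.group (E (arrow h)) := fun h' =>
        Set.ext_iff.1 hUeq (arrow h')
      obtain ⟨n, hn⟩ := exists_cong_subset
        (hU.preimage (Continuous.prodMk_right g)) (x := x) ((hmem h).2 rfl)
      refine ⟨n, fun x' y' h' hc => ?_⟩
      rw [key h', key h]
      exact (hmem h').1 (hn x' hc) }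

open Classical in
theorem IsArrowHom.orbitCocycle_coc {φ : Omega I → Omega J}
    {E : Arrows (Omega I) → Arrows (Omega J)} (hE : IsArrowHom φ E) (hI : Admissible I)
    (hcont : Continuous E) {g : AffGroup I} {x y : Omega I} (h : PartialAct I g x y) :
    (hE.orbitCocycle hI hcont).coc g x = Arrows.group (E (arrow h)) := by
  have hex : ∃ y, PartialAct I g x y := ⟨y, h⟩
  change (if h : ∃ y, PartialAct I g x y then Arrows.group (E (arrow h.choose_spec)) else 1) = _
  rw [dif_pos hex]
  congr 2
  exact hI.arrows_ext rfl rfl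

theorem IsArrowHom.isLeftInverse {φ : Omega I → Omega J} {φ' : Omega J → Omega I}
    {E : Arrows (Omega I) → Arrows (Omega J)} {E' : Arrows (Omega J) → Arrows (Omega I)}
    (hE : IsArrowHom φ E) (hE' : IsArrowHom φ' E') (hI : Admissible I) (hJ : Admissible J)
    (hcont : Continuous E) (hcont' : Continuous E') (h : Function.LeftInverse E' E) :
    OrbitCocycle.IsLeftInverse (hE'.orbitCocycle hJ hcont') (hE.orbitCocycle hI hcont) := by
  intro g x y hg
  have h1 := (hE.orbitCocycle hI hcont).map hg
  rw [hE'.orbitCocycle_coc hJ hcont' h1]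
  have h2 : arrow h1 = E (arrow hg) :=
    hJ.arrows_ext (a := arrow h1) (b := E (arrow hg)) (hE.source (arrow hg)).symm
      (hE.orbitCocycle_coc hI hcont hg)
  rw [h2, h]
  rfl

theorem nonempty_ringActionEquiv_of_topGroupoidsIsomorphic (hI : Admissible I)
    (hJ : Admissible J) (h : TopGroupoidsIsomorphic (Omega I) (Omega J)) :
    Nonempty (RingActionEquiv I J) := by
  obtain ⟨F, hF⟩ := h
  let E := hF.homeomorph
  have hE : IsArrowHom F.obj E := isArrowHom_mapArrows F
  have hE' := hE.of_inverse hJ E.left_inv E.right_inv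
  exact OrbitCocycle.nonempty_ringActionEquiv
    (hE.isLeftInverse hE' hI hJ E.continuous E.symm.continuous E.left_inv)
    (hE'.isLeftInverse hE hJ hI E.symm.continuous E.continuous E.right_inv) hI hJ

end ArrowMaps

/-! ### Functoriality of the groupoid in ring isomorphisms matching monomials. -/

namespace RingActionEquiv

variable {d e : ℕ} {I : Ideal (PolyRing d)} {J : Ideal (PolyRing e)} (E : RingActionEquiv I J)

/-- The inverse isomorphism. -/
def symm : RingActionEquiv J I where
  exponents := E.exponents.symm
  ring := E.ring.symm
  map_mbar n := by
    rw [RingEquiv.symm_apply_eq, E.map_mbar, AddEquiv.apply_symm_apply]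

/-! ### The induced isomorphism of the affine groups -/

/-- The isomorphism of exponents, extended to `ℤ^d → ℤ^e`. -/
def exponentsInt : (Fin d → ℤ) →+ (Fin e → ℤ) :=
  extendInt ((Nat.castAddMonoidHom ℤ).compLeft (Fin e) |>.comp E.exponents.toAddMonoidHom)

theorem exponentsInt_natCast (n : Fin d → ℕ) :
    E.exponentsInt (fun i => (n i : ℤ)) = fun i => (E.exponents n i : ℤ) :=
  extendInt_natCast _ n

theorem exponentsInt_symm (z : Fin d → ℤ) : E.symm.exponentsInt (E.exponentsInt z) = z := by
  obtain ⟨m, k, rfl⟩ := exists_eq_sub_natCast z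
  rw [map_sub, map_sub, exponentsInt_natCast, exponentsInt_natCast, exponentsInt_natCast,
    exponentsInt_natCast]
  simp only [symm, AddEquiv.symm_apply_apply]

/-- The ring homomorphism from `R_d` that induces the isomorphism on `R_d / I R_d`. -/
def laurentLift : Laurent d →ₐ[ℤ] LaurentQuot J :=
  AddMonoidAlgebra.lift ℤ (LaurentQuot J) (Fin d → ℤ)
    ((zmono J).comp (AddMonoidHom.toMultiplicative E.exponentsInt))

theorem laurentLift_of (n : Multiplicative (Fin d → ℤ)) :
    E.laurentLift (AddMonoidAlgebra.of ℤ (Fin d → ℤ) n) =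
      zmono J (Multiplicative.ofAdd (E.exponentsInt n.toAdd)) := by
  rw [laurentLift, AddMonoidAlgebra.lift_of]
  rfl

theorem laurentLift_polyToLaurent (f : PolyRing d) :
    E.laurentLift (polyToLaurent d f) = quotToLaurent J (E.ring (Ideal.Quotient.mk I f)) := by
  have : E.laurentLift.toRingHom.comp (polyToLaurent d) =
      (quotToLaurent J).comp (E.ring.toRingHom.comp (Ideal.Quotient.mk I)) := by
    refine MvPolynomial.ringHom_ext (fun c => by simp) fun k => ?_
    have hk : (MvPolynomial.X k : PolyRing d) = mono (Pi.single k 1) := by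
      simp [mono, Pi.single_apply, pow_ite]
    rw [hk]
    change E.laurentLift (polyToLaurent d _) = quotToLaurent J (E.ring (mbar I _))
    rw [polyToLaurent_mono, laurentLift_of, E.map_mbar, ← zmono_natCast, ← exponentsInt_natCast]
    rfl
  exact DFunLike.congr_fun this f

/-- The induced map `R_d / I R_d → R_e / J R_e`. -/
def laurentMap : LaurentQuot I →+* LaurentQuot J :=
  Ideal.Quotient.lift (laurentIdeal I) E.laurentLift.toRingHom fun a ha => by
    have hle : laurentIdeal I ≤ RingHom.ker E.laurentLift.toRingHom := by
      rw [laurentIdeal, Ideal.map_le_iff_le_comap]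
      intro f hf
      have : E.laurentLift (polyToLaurent d f) = 0 := by
        rw [laurentLift_polyToLaurent, Ideal.Quotient.eq_zero_iff_mem.2 hf, map_zero, map_zero]
      exact this
    exact hle ha

theorem laurentMap_quotToLaurent (a : PolyRing d ⧸ I) :
    E.laurentMap (quotToLaurent I a) = quotToLaurent J (E.ring a) := by
  obtain ⟨f, rfl⟩ := Ideal.Quotient.mk_surjective a
  exact E.laurentLift_polyToLaurent f

theorem laurentMap_zmono (n : Multiplicative (Fin d → ℤ)) :
    E.laurentMap (zmono I n) = zmono J (Multiplicative.ofAdd (E.exponentsInt n.toAdd)) :=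
  E.laurentLift_of n

/-- It suffices to check the polynomial quotient, since every element becomes polynomial after
multiplication by a unit monomial. -/
theorem laurentMap_symm (b : LaurentQuot I) : E.symm.laurentMap (E.laurentMap b) = b := by
  have key : ∀ a, E.symm.laurentMap (E.laurentMap (quotToLaurent I a)) = quotToLaurent I a := by
    intro a
    rw [laurentMap_quotToLaurent, laurentMap_quotToLaurent]
    congr 1
    exact E.ring.symm_apply_apply a
  obtain ⟨m, a, h⟩ := exists_mbar_mul_eq b
  have h1 := key a
  rw [h, map_mul, map_mul, key, ← zmono_natCast] at h1
  exact (isUnit_zmono _).mul_left_cancel h1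

/-- The induced map `R_d / I R_d ⋊ ℤ^d → R_e / J R_e ⋊ ℤ^e`. -/
def affMap : AffGroup I →* AffGroup J :=
  SemidirectProduct.map (AddMonoidHom.toMultiplicative E.laurentMap.toAddMonoidHom)
    (AddMonoidHom.toMultiplicative E.exponentsInt) fun n => by
      refine MonoidHom.ext fun b => ?_
      apply Multiplicative.toAdd.injective
      change E.laurentMap (zmono I n * b.toAdd) =
        zmono J (Multiplicative.ofAdd (E.exponentsInt n.toAdd)) * E.laurentMap b.toAdd
      rw [map_mul, laurentMap_zmono]

theorem affMap_left (g : AffGroup I) :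
    (E.affMap g).left.toAdd = E.laurentMap g.left.toAdd := rfl

theorem affMap_right (g : AffGroup I) :
    (E.affMap g).right.toAdd = E.exponentsInt g.right.toAdd := rfl

theorem affMap_symm (g : AffGroup I) : E.symm.affMap (E.affMap g) = g := by
  refine SemidirectProduct.ext (Multiplicative.toAdd.injective ?_)
    (Multiplicative.toAdd.injective ?_)
  · rw [affMap_left, affMap_left, laurentMap_symm]
  · rw [affMap_right, affMap_right, exponentsInt_symm]

/-! ### The induced homeomorphism of the completions -/

theorem ring_mul (n : Fin d → ℕ) (a : PolyRing d ⧸ I) :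
    E.ring (mbar I n * a) = mbar J (E.exponents n) * E.ring a := by
  rw [map_mul, E.map_mbar]

/-- The ring isomorphism intertwines the endomorphisms along the exponent bijection, so pulling back
commutes with both closure operations. -/
theorem isConstructible_comap {D : AddSubgroup (PolyRing e ⧸ J)}
    (hD : IsConstructible (act J) D) :
    IsConstructible (act I) (D.comap E.ring.toAddMonoidHom) := by
  induction hD with
  | whole => exact .whole
  | image s D _ ih =>
    have h : AddSubgroup.comap E.ring.toAddMonoidHom (AddSubgroup.map (endo (act J) s) D) =
        AddSubgroup.map (endo (act I) (Multiplicative.ofAdd (E.exponents.symm s.toAdd)))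
          (D.comap E.ring.toAddMonoidHom) := by
      ext a
      constructor
      · rintro ⟨b, hb, hba⟩
        have hba' : mbar J s.toAdd * b = E.ring a := hba
        refine ⟨E.ring.symm b, ?_, E.ring.injective ?_⟩
        · change E.ring (E.ring.symm b) ∈ D
          rwa [RingEquiv.apply_symm_apply]
        · change E.ring (mbar I _ * _) = _
          rw [E.ring_mul, toAdd_ofAdd, AddEquiv.apply_symm_apply, RingEquiv.apply_symm_apply, hba']
      · rintro ⟨b, hb, rfl⟩
        refine ⟨E.ring b, hb, ?_⟩
        change mbar J s.toAdd * E.ring b = E.ring (mbar I _ * b)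
        rw [E.ring_mul, toAdd_ofAdd, AddEquiv.apply_symm_apply]
    rw [h]
    exact .image _ _ ih
  | preimage s D _ ih =>
    have h : AddSubgroup.comap E.ring.toAddMonoidHom (AddSubgroup.comap (endo (act J) s) D) =
        AddSubgroup.comap (endo (act I) (Multiplicative.ofAdd (E.exponents.symm s.toAdd)))
          (D.comap E.ring.toAddMonoidHom) := by
      ext a
      change mbar J s.toAdd * E.ring a ∈ D ↔ E.ring (mbar I _ * a) ∈ D
      rw [E.ring_mul, toAdd_ofAdd, AddEquiv.apply_symm_apply]
    rw [h]
    exact .preimage _ _ ih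

/-- The preimage of a constructible subgroup. -/
def comap (D : Constructible (act J)) : Constructible (act I) :=
  ⟨D.1.comap E.ring.toAddMonoidHom, E.isConstructible_comap D.2⟩

/-- The induced map `Ω_I → Ω_J`. -/
def omegaMap : Omega I →+ Omega J where
  toFun x := ⟨fun D => QuotientAddGroup.map (E.comap D).1 D.1 E.ring.toAddMonoidHom le_rfl
      (x.1 (E.comap D)), by
    intro C D h
    have h' : (E.comap C).1 ≤ (E.comap D).1 := AddSubgroup.comap_mono h
    have hx := x.2 _ _ h'
    obtain ⟨a, ha⟩ := QuotientAddGroup.mk_surjective (x.1 (E.comap C))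
    change proj h (QuotientAddGroup.map _ C.1 _ le_rfl (x.1 (E.comap C))) =
      QuotientAddGroup.map _ D.1 _ le_rfl (x.1 (E.comap D))
    rw [← hx, ← ha]
    rfl⟩
  map_zero' := Subtype.ext (funext fun _ => map_zero _)
  map_add' _ _ := Subtype.ext (funext fun _ => map_add _ _ _)

theorem omegaMap_apply (x : Omega I) (D : Constructible (act J)) (a : PolyRing d ⧸ I)
    (h : x.1 (E.comap D) = QuotientAddGroup.mk a) :
    (E.omegaMap x).1 D = QuotientAddGroup.mk (E.ring a) := by
  change QuotientAddGroup.map (E.comap D).1 D.1 E.ring.toAddMonoidHom le_rfl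
    (x.1 (E.comap D)) = _
  rw [h]
  rfl

theorem omegaMap_toOmega (a : PolyRing d ⧸ I) :
    E.omegaMap (toOmega I a) = toOmega J (E.ring a) := rfl

theorem omegaMap_mulOmega (n : Fin d → ℕ) (x : Omega I) :
    E.omegaMap (mulOmega I n x) = mulOmega J (E.exponents n) (E.omegaMap x) := by
  apply Subtype.ext
  funext D
  obtain ⟨a, ha⟩ := QuotientAddGroup.mk_surjective
    (x.1 (E.comap (pre (act J) (Multiplicative.ofAdd (E.exponents n)) D)))
  have hle : (E.comap (pre (act J) (Multiplicative.ofAdd (E.exponents n)) D)).1 ≤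
      (pre (act I) (Multiplicative.ofAdd n) (E.comap D)).1 := by
    intro b hb
    have hb' : mbar J (E.exponents n) * E.ring b ∈ D.1 := hb
    rw [← E.ring_mul] at hb'
    exact hb'
  have h1 : x.1 (pre (act I) (Multiplicative.ofAdd n) (E.comap D)) = QuotientAddGroup.mk a := by
    rw [← x.2 _ _ hle, ← ha]
    rfl
  rw [E.omegaMap_apply _ D _ (completionMap_apply (act I) _ x _ a h1),
    completionMap_apply (act J) _ _ D _ (E.omegaMap_apply x _ a ha.symm)]
  exact congrArg _ (E.ring_mul n a)

theorem omegaMap_symm (x : Omega I) : E.symm.omegaMap (E.omegaMap x) = x := by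
  apply Subtype.ext
  funext C
  obtain ⟨a, ha⟩ := QuotientAddGroup.mk_surjective (x.1 (E.comap (E.symm.comap C)))
  have hle : (E.comap (E.symm.comap C)).1 ≤ C.1 := by
    intro b hb
    have hb' : E.ring.symm (E.ring b) ∈ C.1 := hb
    rwa [RingEquiv.symm_apply_apply] at hb'
  rw [E.symm.omegaMap_apply _ C _ (E.omegaMap_apply x _ a ha.symm), ← x.2 _ C hle, ← ha]
  exact congrArg _ (E.ring.symm_apply_apply a)

theorem continuous_omegaMap :
    @Continuous _ _ (completionTopology (act I)) (completionTopology (act J)) E.omegaMap := by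
  let : ∀ C : Constructible (act I), TopologicalSpace ((PolyRing d ⧸ I) ⧸ C.1) := fun _ => ⊥
  let : ∀ C : Constructible (act J), TopologicalSpace ((PolyRing e ⧸ J) ⧸ C.1) := fun _ => ⊥
  have : ∀ C : Constructible (act I), DiscreteTopology ((PolyRing d ⧸ I) ⧸ C.1) := fun _ => ⟨rfl⟩
  let := completionTopology (act I)
  have hind : Continuous fun x : Omega I => x.1 := continuous_induced_dom
  refine continuous_induced_rng.2 (continuous_pi fun D => ?_)
  exact (continuous_of_discreteTopology (f := QuotientAddGroup.map (E.comap D).1 D.1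
    E.ring.toAddMonoidHom le_rfl)).comp ((continuous_apply (E.comap D)).comp hind)

/-! ### The induced isomorphism of groupoids -/

theorem partialAct_map {g : AffGroup I} {x y : Omega I} (h : PartialAct I g x y) :
    PartialAct J (E.affMap g) (E.omegaMap x) (E.omegaMap y) := by
  obtain ⟨m, k, a, h1, h2, h3⟩ := h
  refine ⟨E.exponents m, E.exponents k, E.ring a, fun i => ?_, ?_, ?_⟩
  · have hk : (fun i => (k i : ℤ)) = (fun i => (m i : ℤ)) + g.right.toAdd := funext h1
    have := congrArg (fun z => E.exponentsInt z i) hk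
    simp only [map_add, exponentsInt_natCast] at this
    exact this
  · rw [← laurentMap_quotToLaurent, h2, map_mul, laurentMap_quotToLaurent]
    change quotToLaurent J (E.ring (mbar I m)) * _ = _
    rw [E.map_mbar]
    rfl
  · have := congrArg E.omegaMap h3
    rwa [map_add, omegaMap_mulOmega, omegaMap_mulOmega, omegaMap_toOmega] at this

/-- The induced homomorphism of groupoids. -/
def functor : Omega I ⥤ Omega J where
  obj := E.omegaMap
  map f := ⟨E.affMap f.1, E.partialAct_map f.2⟩
  map_id _ := Subtype.ext (map_one E.affMap)
  map_comp f g := Subtype.ext (map_mul E.affMap g.1 f.1)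

theorem continuous_mapArrows : Continuous (mapArrows E.functor) := by
  let := completionTopology (act I)
  let := completionTopology (act J)
  let : TopologicalSpace (AffGroup I) := ⊥
  let : TopologicalSpace (AffGroup J) := ⊥
  have : DiscreteTopology (AffGroup I) := ⟨rfl⟩
  have hind : Continuous fun a : Arrows (Omega I) =>
      ((a.2.2.1, a.1) : AffGroup I × Omega I) := continuous_induced_dom
  refine continuous_induced_rng.2 ?_
  exact ((continuous_of_discreteTopology (f := E.affMap)).comp
    (continuous_fst.comp hind)).prodMk (E.continuous_omegaMap.comp (continuous_snd.comp hind))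

theorem mapArrows_symm (hI : Admissible I) (a : Arrows (Omega I)) :
    mapArrows E.symm.functor (mapArrows E.functor a) = a :=
  hI.arrows_ext (E.omegaMap_symm a.1) (E.affMap_symm a.2.2.1)

theorem topGroupoidsIsomorphic (E : RingActionEquiv I J) (hI : Admissible I) (hJ : Admissible J) :
    TopGroupoidsIsomorphic (Omega I) (Omega J) := by
  let H : Arrows (Omega I) ≃ₜ Arrows (Omega J) :=
    { toFun := mapArrows E.functor
      invFun := mapArrows E.symm.functor
      left_inv := E.mapArrows_symm hI
      right_inv := E.symm.mapArrows_symm hJ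
      continuous_toFun := E.continuous_mapArrows
      continuous_invFun := E.symm.continuous_mapArrows }
  exact ⟨E.functor, H.isHomeomorph⟩

end RingActionEquiv

end AlgAct

end

theorem mainTheorem9 (d₁ d₂ : ℕ) (hd₁ : 0 < d₁) (hd₂ : 0 < d₂)
    (I₁ : Ideal (AlgAct.PolyRing d₁)) (I₂ : Ideal (AlgAct.PolyRing d₂))
    (hI₁ : I₁ ≠ ⊥) (hI₂ : I₂ ≠ ⊥)
    (hfin₁ : Module.Finite ℤ (AlgAct.PolyRing d₁ ⧸ I₁))
    (hfin₂ : Module.Finite ℤ (AlgAct.PolyRing d₂ ⧸ I₂))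
    (htf₁ : IsAddTorsionFree (AlgAct.PolyRing d₁ ⧸ I₁))
    (htf₂ : IsAddTorsionFree (AlgAct.PolyRing d₂ ⧸ I₂))
    (ha₁ : (AlgAct.variety I₁).Finite ∧ ∀ k, (MvPolynomial.X k : AlgAct.PolyRing d₁) ∉ I₁)
    (ha₂ : (AlgAct.variety I₂).Finite ∧ ∀ k, (MvPolynomial.X k : AlgAct.PolyRing d₂) ∉ I₂)
    (hb₁ : ∀ z ∈ AlgAct.variety I₁, ∀ k, z k ≠ 0)
    (hb₂ : ∀ z ∈ AlgAct.variety I₂, ∀ k, z k ≠ 0)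
    (hc₁ : ∃ n : Fin d₁ → ℕ, ∀ z ∈ AlgAct.variety I₁,
      MvPolynomial.aeval z (AlgAct.mono n) ≠ 1)
    (hc₂ : ∃ n : Fin d₂ → ℕ, ∀ z ∈ AlgAct.variety I₂,
      MvPolynomial.aeval z (AlgAct.mono n) ≠ 1)
    (hdd₁ : ∀ j : Fin d₁, ∃ p : ℕ, p.Prime ∧
      (∃ c : ℤ, AlgAct.absNorm (AlgAct.udot I₁ j) = p * c) ∧
      ∀ k : Fin d₁, k ≠ j → ¬ ∃ c : ℤ, AlgAct.absNorm (AlgAct.udot I₁ k) = p * c)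
    (hdd₂ : ∀ j : Fin d₂, ∃ p : ℕ, p.Prime ∧
      (∃ c : ℤ, AlgAct.absNorm (AlgAct.udot I₂ j) = p * c) ∧
      ∀ k : Fin d₂, k ≠ j → ¬ ∃ c : ℤ, AlgAct.absNorm (AlgAct.udot I₂ k) = p * c) :
    AlgAct.ActionsIsomorphic (AlgAct.act I₁) (AlgAct.act I₂) ↔
      AlgAct.TopGroupoidsIsomorphic (AlgAct.Omega I₁) (AlgAct.Omega I₂) := by
  have h₁ := AlgAct.admissible_of_hypotheses I₁ hfin₁ htf₁ hb₁ hc₁ hdd₁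
  have h₂ := AlgAct.admissible_of_hypotheses I₂ hfin₂ htf₂ hb₂ hc₂ hdd₂
  constructor
  · intro h
    obtain ⟨E⟩ := AlgAct.nonempty_ringActionEquiv_of_actionsIsomorphic htf₁ htf₂ h
    exact E.topGroupoidsIsomorphic h₁ h₂
  · intro h
    obtain ⟨E⟩ := AlgAct.nonempty_ringActionEquiv_of_topGroupoidsIsomorphic h₁ h₂ h
    exact E.actionsIsomorphic
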